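/- **Setting.** Let $\lambda\in\mathbb C$ with $|\lambda|>1$ and let $p,q\in\mathbb C[X]$ with $p(0)=0$, $p'(0)=\lambda$, $q(0)=0$, $q'(0)\neq 0$. Let $$F(t,z)=\Big(\frac t\lambda,\;p(z)+q(t)\Big)\quad\text{on }\mathbb C^2,$$ and write $\pi_2(t,z)=z$. Let $x_0$ be a critical point of $p$ of order at least $3$ (that is, a zero of $p'$ of multiplicity at least $3$) with $p^k(x_0)=0$, where $p^k$ is the $k$-th iterate and $k\in\mathbb N$. Put $\varphi_{n,j}(w)=\pi_2F^j(w/\lambda^n,x_0)$, a polynomial in $w$. For $j\ge k$ the coefficient of $w^2$ in $\varphi_{n,j}$ has the form $$X_2\lambda^{-2n+2j}+X_1\lambda^{-2n+j}+X_0\lambda^{-2n}+X_{-1}\lambda^{-2n-j}+X_{-2}\lambda^{-2n-2j}$$ with unique constants $X_i$ independent of $n$ and $j$; assume that $F$ is *degenerate resonant*, i.e. $X_1=0$. Finally let $w_0\in\mathbb C$ be such that $\pi_2F^n(w_0/\lambda^n,x_0)\to x_0$ as $n\to\infty$, and let $$D_n=\Big\{\Big(\frac{w_0}{\lambda^n},z\Big)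 : |z-x_0|<|\lambda|^{-3n/4}\Big\}.$$ The $\omega$-limit set of $D\subset\mathbb C^2$ is $\bigcap_{N}\overline{\bigcup_{j\ge N}F^j(D)}$. A vertical disk is a set $\{t\}\times\{z:|z-c|<r\}$ with $t,c\in\mathbb C$, $r>0$. Consider sets of the form $\Omega=\{x_{-\ell}\}_{\ell=-k}^{+\infty}\subset\mathbb C$, where the entry with index $0$ is the given critical point $x_0$ and $$p(x_{-\ell})=x_{-\ell+1}\ \text{ for all } \ell>-k,\qquad \lim_{\ell\to\infty}x_{-\ell}=0. \tag{$*$}$$ (In particular $x_k=p^k(x_0)=0\in\Omega$.) **Lemma 5.5 ($\omega$-limit sets of the disks).** For each sufficiently large $n\in\mathbb N$ there is a set $\Omega=\{x_{-\ell}\}_{\ell=-k}^{+\infty}$ as in $(*)$ that is closed and invariant, $p(\Omega)=\Omega$, such that the $\omega$-limit set of $D_n$ is $\{0\}\times\Omega$. Conversely, for each set $\Omega=\{x_{-\ell}\}_{\ell=-k}^{+\infty}$ satisfying $(*)$ there is a vertical disk whose $\omega$-limit set is $\{0\}\times\Omega$. -/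

import Mathlib

open Filter Topology Polynomial

noncomputable section

/-- The polynomial skew-product `F(t, z) = (t / lam, p(z) + q(t))` of `ℂ²`. -/
def skewProduct (lam : ℂ) (p q : ℂ[X]) (y : ℂ × ℂ) : ℂ × ℂ :=
  (y.1 / lam, p.eval y.2 + q.eval y.1)

/-- The function `φ_{n,j}(w) = π₂ F^j(w / lam ^ n, x₀)` as a polynomial in the variable `w`;
see `skewProduct_iterate` for the identification. -/
def orbitPoly (lam : ℂ) (p q : ℂ[X]) (x₀ : ℂ) (n : ℕ) : ℕ → ℂ[X]
  | 0 => C x₀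
  | j + 1 => p.comp (orbitPoly lam p q x₀ n j) + q.comp (C ((lam ^ (n + j))⁻¹) * X)

theorem skewProduct_iterate (lam : ℂ) (p q : ℂ[X]) (x₀ : ℂ) (n j : ℕ) (w : ℂ) :
    (skewProduct lam p q)^[j] (w / lam ^ n, x₀) =
      (w / lam ^ (n + j), (orbitPoly lam p q x₀ n j).eval w) := by
  induction j with
  | zero => simp [orbitPoly]
  | succ j ih =>
    rw [Function.iterate_succ_apply', ih]
    simp only [skewProduct, orbitPoly, eval_add, eval_comp, eval_mul, eval_C, eval_X,
      Prod.mk.injEq]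
    refine ⟨?_, ?_⟩
    · rw [div_div, ← pow_succ, add_assoc]
    · rw [div_eq_inv_mul]

/-- The quadratic part (in `w`) of `φ_{n,j}(w) = π₂ F^j(w / lam ^ n, x₀)`, for `j ≥ k`, has the form
`w² (X₂ lam^(-2n+2j) + X₁ lam^(-2n+j) + X₀ lam^(-2n) + X₋₁ lam^(-2n-j) + X₋₂ lam^(-2n-2j))`
with constants independent of `n` and `j` (unique, as the powers of `lam` are linearly independent
functions of `j` when `1 < ‖lam‖`). The skew-product is degenerate resonant if `X₁ = 0`. -/
def IsDegenerateResonant (lam : ℂ) (p q : ℂ[X]) (x₀ : ℂ) (k : ℕ) : Prop :=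
  ∃ X2 X1 X0 Xm1 Xm2 : ℂ,
    (∀ n j : ℕ, k ≤ j →
      (orbitPoly lam p q x₀ n j).coeff 2 =
        X2 * lam ^ (-2 * (n : ℤ) + 2 * (j : ℤ)) + X1 * lam ^ (-2 * (n : ℤ) + (j : ℤ))
          + X0 * lam ^ (-2 * (n : ℤ)) + Xm1 * lam ^ (-2 * (n : ℤ) - (j : ℤ))
          + Xm2 * lam ^ (-2 * (n : ℤ) - 2 * (j : ℤ))) ∧
    X1 = 0

/-- The open vertical disk of radius `r` centered at `(t, c)`. -/
def verticalDisk (t c : ℂ) (r : ℝ) : Set (ℂ × ℂ) :=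
  {t} ×ˢ Metric.ball c r

/-- The disk `D_n = {(w₀ / lam ^ n, z) : |z - x₀| < |lam| ^ (-3n/4)}` in a critical fiber. -/
def criticalDisk (lam x₀ w₀ : ℂ) (n : ℕ) : Set (ℂ × ℂ) :=
  verticalDisk (w₀ / lam ^ n) x₀ (‖lam‖ ^ (-(3 * (n : ℝ) / 4)))

/-- The `ω`-limit set `⋂_N closure (⋃_{j ≥ N} F^j(D))` of a set `D`. -/
def omegaSet (F : ℂ × ℂ → ℂ × ℂ) (D : Set (ℂ × ℂ)) : Set (ℂ × ℂ) :=
  omegaLimit atTop (fun (j : ℕ) (y : ℂ × ℂ) => F^[j] y) D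

/-- `(x m)`, `m ≤ k`, is an orbit of `p` through the given point `x₀` at time `0`, and its backward
part `x (-ℓ)` converges to `0`. Only the values at `m ≤ k` matter. -/
def IsBackwardOrbit (p : ℂ[X]) (x₀ : ℂ) (k : ℕ) (x : ℤ → ℂ) : Prop :=
  x 0 = x₀ ∧ (∀ m : ℤ, m < (k : ℤ) → p.eval (x m) = x (m + 1)) ∧
    Tendsto (fun l : ℕ => x (-(l : ℤ))) atTop (𝓝 0)

/-- The set `Ω = {x_{-ℓ} : ℓ ≥ -k}`. -/
def orbitSet (k : ℕ) (x : ℤ → ℂ) : Set ℂ :=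
  {z | ∃ l : ℤ, -(k : ℤ) ≤ l ∧ z = x (-l)}

end

/-! Write φ_j(t) for the second coordinate of F^j(t, x₀). As long as |lam|^j |t| is small the
critical orbit stays near the saddle at the origin and its Taylor expansion in t is under control.
Compare φ_{j+1}(t/lam) with φ_j(t): the linear coefficients differ by O(|lam|^(-j)), the condition
X₁ = 0 keeps the difference of the quadratic ones bounded, and the remainder is O(ν^j |t|³) for any
ν > |lam|. At t = w/lam^n this shows that φ_n(w/lam^n) converges to some h(w) with error
O((ν/|lam|³)^n) (`exists_norm_rescaled_succ_sub_le`, `exists_rescaled_limit`). The limit satisfies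
h(lam w) = p(h(w)) and h(w) = A w + O(w²), so l ↦ h(w₀/lam^l) is a backward orbit of h(w₀) = x₀
tending to 0.

Fourth-order contact at x₀ turns the radius |lam|^(-3n/4) of D_n into O(|lam|^(-3n)) in one step,
and the rest of the passage expands by at most a constant times ν^n. Thus F^n(D_n) lies within
O((ν/|lam|³)^n) of x₀, which for ν² < |lam|³ is smaller than the radius |lam|^(-3n/2) of D_{2n}
(`exists_criticalDisk_mapsTo`). The disk therefore makes passages of lengths n, 2n, 4n, …, each
following Ω more closely, and its ω-limit set is {0} × Ω (`omegaSet_eq_of_passages`).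

For the converse, h(w₀) = x₀ ≠ 0 forces A ≠ 0. A backward orbit tending to 0 is determined by its
leading asymptotics ζ/lam^l, so each one is l ↦ h(w/lam^l) with w = ζ/A
(`exists_rescaled_limit_eq`), and the argument above applies to w in place of w₀. -/

/-! ### Lipschitz and Taylor estimates for polynomials. -/

/-- A `C¹` map is Lipschitz on every ball around the origin. -/
theorem exists_lipschitz_on_ball {E F : Type*} [NormedAddCommGroup E] [NormedSpace ℝ E]
    [ProperSpace E] [NormedAddCommGroup F] [NormedSpace ℝ F] {f : E → F} (hf : ContDiff ℝ 1 f)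
    (R : ℝ) :
    ∃ K : ℝ, 0 < K ∧ ∀ a b : E, ‖a‖ ≤ R → ‖b‖ ≤ R → ‖f a - f b‖ ≤ K * ‖a - b‖ := by
  obtain ⟨K, hK⟩ := (hf.contDiffOn (s := Metric.closedBall (0 : E) R)).exists_lipschitzOnWith
    (by norm_num) (convex_closedBall 0 R) (isCompact_closedBall 0 R)
  refine ⟨K + 1, by positivity, fun a b ha hb => ?_⟩
  have := hK.norm_sub_le (mem_closedBall_zero_iff.2 ha) (mem_closedBall_zero_iff.2 hb)
  nlinarith [norm_nonneg (a - b)]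

theorem Polynomial.contDiff_real (f : ℂ[X]) : ContDiff ℝ 1 (fun z : ℂ => f.eval z) :=
  f.differentiable.contDiff.restrict_scalars ℝ

theorem Polynomial.exists_norm_eval_le (f : ℂ[X]) (R : ℝ) :
    ∃ K : ℝ, 0 < K ∧ ∀ z : ℂ, ‖z‖ ≤ R → ‖f.eval z‖ ≤ K := by
  obtain ⟨K, hK⟩ := (isCompact_closedBall (0 : ℂ) R).exists_bound_of_continuousOn
    (f := fun z => f.eval z) f.continuous.continuousOn
  exact ⟨|K| + 1, by positivity, fun z hz =>
    (hK z (mem_closedBall_zero_iff.2 hz)).trans (by linarith [le_abs_self K])⟩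

theorem Polynomial.eval_eq_cubic (f : ℂ[X]) (z : ℂ) :
    f.eval z = f.coeff 0 + f.coeff 1 * z + f.coeff 2 * z ^ 2
      + f.divX.divX.divX.eval z * z ^ 3 := by
  have h0 := congrArg (eval z) (divX_mul_X_add f)
  have h1 := congrArg (eval z) (divX_mul_X_add f.divX)
  have h2 := congrArg (eval z) (divX_mul_X_add f.divX.divX)
  simp only [eval_add, eval_mul, eval_X, eval_C, coeff_divX] at h0 h1 h2
  rw [← h0, ← h1, ← h2]
  ring

theorem Polynomial.exists_norm_sub_taylor_two_le (f : ℂ[X]) :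
    ∃ K : ℝ, 0 < K ∧ ∀ z : ℂ, ‖z‖ ≤ 1 →
      ‖f.eval z - f.coeff 0 - f.coeff 1 * z - f.coeff 2 * z ^ 2‖ ≤ K * ‖z‖ ^ 3 := by
  obtain ⟨K, hK, h⟩ := f.divX.divX.divX.exists_norm_eval_le 1
  refine ⟨K, hK, fun z hz => ?_⟩
  rw [f.eval_eq_cubic z, ← norm_pow]
  calc _ = ‖f.divX.divX.divX.eval z * z ^ 3‖ := by congr 1; ring
    _ ≤ _ := by rw [norm_mul]; gcongr; exact h z hz

theorem Polynomial.exists_norm_sub_taylor_one_le (f : ℂ[X]) :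
    ∃ K : ℝ, 0 < K ∧ ∀ z : ℂ, ‖z‖ ≤ 1 →
      ‖f.eval z - f.coeff 0 - f.coeff 1 * z‖ ≤ K * ‖z‖ ^ 2 := by
  obtain ⟨K, hK, h⟩ := f.exists_norm_sub_taylor_two_le
  refine ⟨K + ‖f.coeff 2‖, by positivity, fun z hz => ?_⟩
  calc _ = ‖(f.eval z - f.coeff 0 - f.coeff 1 * z - f.coeff 2 * z ^ 2)
        + f.coeff 2 * z ^ 2‖ := by congr 1; ring
    _ ≤ K * ‖z‖ ^ 3 + ‖f.coeff 2‖ * ‖z‖ ^ 2 := by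
      refine (norm_add_le _ _).trans (add_le_add (h z hz) ?_)
      rw [norm_mul, norm_pow]
    _ ≤ _ := by
      have : ‖z‖ ^ 3 ≤ ‖z‖ ^ 2 := pow_le_pow_of_le_one (norm_nonneg _) hz (by norm_num)
      nlinarith

theorem Polynomial.exists_norm_sub_taylor_zero_le (f : ℂ[X]) :
    ∃ K : ℝ, 0 < K ∧ ∀ z : ℂ, ‖z‖ ≤ 1 → ‖f.eval z - f.coeff 0‖ ≤ K * ‖z‖ := by
  obtain ⟨K, hK, h⟩ := f.exists_norm_sub_taylor_one_le
  refine ⟨K + ‖f.coeff 1‖, by positivity, fun z hz => ?_⟩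
  calc _ = ‖(f.eval z - f.coeff 0 - f.coeff 1 * z) + f.coeff 1 * z‖ := by congr 1; ring
    _ ≤ K * ‖z‖ ^ 2 + ‖f.coeff 1‖ * ‖z‖ := by
      refine (norm_add_le _ _).trans (add_le_add (h z hz) ?_)
      rw [norm_mul]
    _ ≤ _ := by
      have : ‖z‖ ^ 2 ≤ ‖z‖ := by nlinarith [norm_nonneg z]
      nlinarith

/-- Third order control of the increments of a polynomial near the origin. -/
theorem Polynomial.exists_norm_increment_le_cubic (f : ℂ[X]) :
    ∃ K : ℝ, 0 < K ∧ ∀ z z' : ℂ, ‖z‖ ≤ 1 → ‖z'‖ ≤ 1 →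
      ‖f.eval z' - f.eval z - f.coeff 1 * (z' - z) - f.coeff 2 * (z' ^ 2 - z ^ 2)‖
        ≤ K * (‖z‖ + ‖z'‖) ^ 2 * ‖z' - z‖ := by
  set P := f.divX.divX.divX
  obtain ⟨K, hK, h⟩ := P.exists_norm_eval_le 1
  obtain ⟨M, hM, h'⟩ := exists_lipschitz_on_ball P.contDiff_real 1
  refine ⟨K + M, by positivity, fun z z' hz hz' => ?_⟩
  have e : f.eval z' - f.eval z - f.coeff 1 * (z' - z) - f.coeff 2 * (z' ^ 2 - z ^ 2)
      = P.eval z' * ((z' ^ 2 + z' * z + z ^ 2) * (z' - z))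
        + (P.eval z' - P.eval z) * z ^ 3 := by
    rw [f.eval_eq_cubic z, f.eval_eq_cubic z']
    ring
  rw [e]
  have h1 : ‖z' ^ 2 + z' * z + z ^ 2‖ ≤ (‖z‖ + ‖z'‖) ^ 2 := by
    calc _ ≤ ‖z'‖ ^ 2 + ‖z'‖ * ‖z‖ + ‖z‖ ^ 2 := by
          refine (norm_add₃_le).trans (le_of_eq ?_)
          simp
      _ ≤ _ := by nlinarith [norm_nonneg z, norm_nonneg z', mul_nonneg (norm_nonneg z)
                    (norm_nonneg z')]
  have h2 : ‖z‖ ^ 3 ≤ (‖z‖ + ‖z'‖) ^ 2 := by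
    calc ‖z‖ ^ 3 ≤ ‖z‖ ^ 2 := pow_le_pow_of_le_one (norm_nonneg _) hz (by norm_num)
      _ ≤ _ := by gcongr; linarith [norm_nonneg z']
  calc _ ≤ K * ((‖z‖ + ‖z'‖) ^ 2 * ‖z' - z‖) + M * ‖z' - z‖ * (‖z‖ + ‖z'‖) ^ 2 := by
        refine (norm_add_le _ _).trans (add_le_add ?_ ?_)
        · rw [norm_mul, norm_mul]
          gcongr
          exact h z' hz'
        · rw [norm_mul, norm_pow]
          gcongr
          exact h' z' z hz' hz
    _ = _ := by ring

theorem Polynomial.exists_norm_increment_le (f : ℂ[X]) :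
    ∃ K : ℝ, 0 < K ∧ ∀ z z' : ℂ, ‖z‖ ≤ 1 → ‖z'‖ ≤ 1 →
      ‖f.eval z' - f.eval z - f.coeff 1 * (z' - z)‖ ≤ K * (‖z‖ + ‖z'‖) * ‖z' - z‖ := by
  obtain ⟨K, hK, h⟩ := f.exists_norm_increment_le_cubic
  refine ⟨2 * K + ‖f.coeff 2‖, by positivity, fun z z' hz hz' => ?_⟩
  have h1 := h z z' hz hz'
  have e : f.eval z' - f.eval z - f.coeff 1 * (z' - z)
      = (f.eval z' - f.eval z - f.coeff 1 * (z' - z) - f.coeff 2 * (z' ^ 2 - z ^ 2))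
        + f.coeff 2 * ((z + z') * (z' - z)) := by ring
  rw [e]
  refine (norm_add_le _ _).trans ?_
  have h2 : ‖f.coeff 2 * ((z + z') * (z' - z))‖ ≤ ‖f.coeff 2‖ * ((‖z‖ + ‖z'‖) * ‖z' - z‖) := by
    rw [norm_mul, norm_mul]
    gcongr
    exact norm_add_le _ _
  have h3 : K * (‖z‖ + ‖z'‖) ^ 2 * ‖z' - z‖ ≤ 2 * K * ((‖z‖ + ‖z'‖) * ‖z' - z‖) := by
    have : (‖z‖ + ‖z'‖) ^ 2 ≤ 2 * (‖z‖ + ‖z'‖) := by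
      nlinarith [norm_nonneg z, norm_nonneg z']
    calc _ ≤ K * (2 * (‖z‖ + ‖z'‖)) * ‖z' - z‖ := by gcongr
      _ = _ := by ring
  linarith

/-- At a critical point of order at least `3`, a polynomial is constant up to fourth order. -/
theorem Polynomial.exists_norm_sub_le_pow_four {p : ℂ[X]} {x₀ : ℂ}
    (hx₀ : 3 ≤ p.derivative.rootMultiplicity x₀) :
    ∃ K : ℝ, 0 < K ∧ ∀ z : ℂ, ‖z - x₀‖ ≤ 1 → ‖p.eval z - p.eval x₀‖ ≤ K * ‖z - x₀‖ ^ 4 := by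
  set f := p - C (p.eval x₀) with hf
  have hroot : f.IsRoot x₀ := by simp [hf]
  have hd : f.derivative = p.derivative := by simp [hf]
  have h1 := derivative_rootMultiplicity_of_root hroot
  rw [hd] at h1
  obtain ⟨S, hS⟩ := (pow_dvd_pow (X - C x₀) (show 4 ≤ f.rootMultiplicity x₀ by omega)).trans
    (pow_rootMultiplicity_dvd f x₀)
  obtain ⟨K, hK, h⟩ := S.exists_norm_eval_le (1 + ‖x₀‖)
  refine ⟨K, hK, fun z hz => ?_⟩
  have e : p.eval z - p.eval x₀ = (z - x₀) ^ 4 * S.eval z := by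
    have := congrArg (eval z) hS
    simpa [hf] using this
  rw [e, norm_mul, norm_pow, mul_comm]
  gcongr
  apply h
  calc ‖z‖ = ‖(z - x₀) + x₀‖ := by simp
    _ ≤ _ := (norm_add_le _ _).trans (by linarith)

theorem Polynomial.coeff_one_comp_of_coeff_zero (f : ℂ[X]) {g : ℂ[X]} (hg : g.coeff 0 = 0) :
    (f.comp g).coeff 1 = f.coeff 1 * g.coeff 1 := by
  obtain ⟨h, rfl⟩ := X_dvd_iff.2 hg
  conv_lhs => rw [← divX_mul_X_add f, ← divX_mul_X_add f.divX]
  simp only [add_comp, mul_comp, X_comp, C_comp, add_mul, coeff_add, coeff_C, coeff_divX]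
  rw [show (f.divX.divX.comp (X * h)) * (X * h) * (X * h)
    = X ^ 2 * (f.divX.divX.comp (X * h) * h * h) by ring, coeff_X_pow_mul']
  simp [coeff_X_mul]

theorem Polynomial.coeff_two_comp_of_coeff_zero (f : ℂ[X]) {g : ℂ[X]} (hg : g.coeff 0 = 0) :
    (f.comp g).coeff 2 = f.coeff 1 * g.coeff 2 + f.coeff 2 * g.coeff 1 ^ 2 := by
  obtain ⟨h, rfl⟩ := X_dvd_iff.2 hg
  conv_lhs => rw [← divX_mul_X_add f, ← divX_mul_X_add f.divX, ← divX_mul_X_add f.divX.divX]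
  simp only [add_comp, mul_comp, X_comp, C_comp, add_mul, coeff_add, coeff_C, coeff_divX]
  rw [show (f.divX.divX.divX.comp (X * h)) * (X * h) * (X * h) * (X * h)
    = X ^ 3 * (f.divX.divX.divX.comp (X * h) * h * h * h) by ring, coeff_X_pow_mul',
    show C (f.coeff (0 + 1 + 1)) * (X * h) * (X * h)
    = C (f.coeff 2) * (X ^ 2 * (h * h)) by ring, coeff_C_mul, coeff_X_pow_mul']
  simp [coeff_X_mul, mul_coeff_zero]
  ring

/-! ### The critical orbit and recursions for its Taylor coefficients. -/

/-- The second coordinate of `F^j(t, x₀)`. -/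
noncomputable def criticalOrbit (lam : ℂ) (p q : ℂ[X]) (x₀ : ℂ) (j : ℕ) (t : ℂ) : ℂ :=
  (orbitPoly lam p q x₀ 0 j).eval t

section Basic

variable {lam : ℂ} {p q : ℂ[X]} {x₀ : ℂ} {k : ℕ}

theorem skewProduct_iterate_critical (lam : ℂ) (p q : ℂ[X]) (x₀ : ℂ) (j : ℕ) (t : ℂ) :
    (skewProduct lam p q)^[j] (t, x₀) = (t / lam ^ j, criticalOrbit lam p q x₀ j t) := by
  simpa [criticalOrbit] using skewProduct_iterate lam p q x₀ 0 j t

theorem skewProduct_iterate_fst (lam : ℂ) (p q : ℂ[X]) (j : ℕ) (y : ℂ × ℂ) :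
    ((skewProduct lam p q)^[j] y).1 = y.1 / lam ^ j := by
  induction j with
  | zero => simp
  | succ j ih => rw [Function.iterate_succ_apply', skewProduct, ih, div_div, ← pow_succ]

theorem skewProduct_iterate_succ_snd (lam : ℂ) (p q : ℂ[X]) (j : ℕ) (y : ℂ × ℂ) :
    ((skewProduct lam p q)^[j + 1] y).2 =
      p.eval ((skewProduct lam p q)^[j] y).2 + q.eval (y.1 / lam ^ j) := by
  rw [Function.iterate_succ_apply', skewProduct, skewProduct_iterate_fst]

theorem criticalOrbit_eq_snd (lam : ℂ) (p q : ℂ[X]) (x₀ : ℂ) (j : ℕ) (t : ℂ) :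
    criticalOrbit lam p q x₀ j t = ((skewProduct lam p q)^[j] (t, x₀)).2 := by
  rw [skewProduct_iterate_critical]

theorem criticalOrbit_succ (lam : ℂ) (p q : ℂ[X]) (x₀ : ℂ) (j : ℕ) (t : ℂ) :
    criticalOrbit lam p q x₀ (j + 1) t =
      p.eval (criticalOrbit lam p q x₀ j t) + q.eval (t / lam ^ j) := by
  simp only [criticalOrbit_eq_snd, skewProduct_iterate_succ_snd]

theorem criticalOrbit_zero_right (hq0 : q.coeff 0 = 0) (j : ℕ) :
    criticalOrbit lam p q x₀ j 0 = (fun z => p.eval z)^[j] x₀ := by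
  induction j with
  | zero => simp [criticalOrbit, orbitPoly]
  | succ j ih =>
    rw [criticalOrbit_succ, ih, Function.iterate_succ_apply', zero_div,
      ← coeff_zero_eq_eval_zero, hq0, add_zero]

theorem iterate_eval_eq_zero (hp0 : p.coeff 0 = 0)
    (hk : (fun z : ℂ => p.eval z)^[k] x₀ = 0) {j : ℕ} (hj : k ≤ j) :
    (fun z : ℂ => p.eval z)^[j] x₀ = 0 := by
  induction j, hj using Nat.le_induction with
  | base => exact hk
  | succ j _ ih => rw [Function.iterate_succ_apply', ih, ← coeff_zero_eq_eval_zero, hp0]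

theorem orbitPoly_coeff_zero (hp0 : p.coeff 0 = 0) (hq0 : q.coeff 0 = 0)
    (hk : (fun z : ℂ => p.eval z)^[k] x₀ = 0) {j : ℕ} (hj : k ≤ j) :
    (orbitPoly lam p q x₀ 0 j).coeff 0 = 0 := by
  rw [coeff_zero_eq_eval_zero]
  exact (criticalOrbit_zero_right hq0 j).trans (iterate_eval_eq_zero hp0 hk hj)

theorem orbitPoly_coeff_one_succ (hp0 : p.coeff 0 = 0) (hp1 : p.coeff 1 = lam)
    (hq0 : q.coeff 0 = 0) (hk : (fun z : ℂ => p.eval z)^[k] x₀ = 0) {j : ℕ} (hj : k ≤ j) :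
    (orbitPoly lam p q x₀ 0 (j + 1)).coeff 1 =
      lam * (orbitPoly lam p q x₀ 0 j).coeff 1 + q.coeff 1 / lam ^ j := by
  rw [orbitPoly, coeff_add, coeff_one_comp_of_coeff_zero _ (orbitPoly_coeff_zero hp0 hq0 hk hj),
    coeff_one_comp_of_coeff_zero _ (by simp), hp1]
  simp [div_eq_mul_inv]

theorem orbitPoly_coeff_two_succ (hp0 : p.coeff 0 = 0) (hp1 : p.coeff 1 = lam)
    (hq0 : q.coeff 0 = 0) (hk : (fun z : ℂ => p.eval z)^[k] x₀ = 0) {j : ℕ} (hj : k ≤ j) :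
    (orbitPoly lam p q x₀ 0 (j + 1)).coeff 2 =
      lam * (orbitPoly lam p q x₀ 0 j).coeff 2
        + p.coeff 2 * (orbitPoly lam p q x₀ 0 j).coeff 1 ^ 2
        + q.coeff 2 / (lam ^ j) ^ 2 := by
  rw [orbitPoly, coeff_add, coeff_two_comp_of_coeff_zero _ (orbitPoly_coeff_zero hp0 hq0 hk hj),
    coeff_two_comp_of_coeff_zero _ (by simp), hp1]
  simp [div_eq_mul_inv]

end Basic

/-! ### Growth of the critical orbit near the saddle. -/

section Growth

variable {lam : ℂ} {p q : ℂ[X]} {x₀ : ℂ} {k : ℕ}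

theorem norm_div_pow_le (hlam : 1 < ‖lam‖) (t : ℂ) (j : ℕ) : ‖t / lam ^ j‖ ≤ ‖t‖ := by
  rw [norm_div, norm_pow]
  exact div_le_self (norm_nonneg _) (one_le_pow₀ hlam.le)

theorem norm_le_pow_mul (hlam : 1 < ‖lam‖) (t : ℂ) (j : ℕ) : ‖t‖ ≤ ‖lam‖ ^ j * ‖t‖ :=
  le_mul_of_one_le_left (norm_nonneg _) (one_le_pow₀ hlam.le)

theorem pow_mul_le_succ (hlam : 1 < ‖lam‖) (t : ℂ) (j : ℕ) :
    ‖lam‖ ^ j * ‖t‖ ≤ ‖lam‖ ^ (j + 1) * ‖t‖ := by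
  gcongr
  · exact hlam.le
  · omega

/-- Before leaving a neighbourhood of the saddle, the critical orbit grows linearly. -/
theorem exists_norm_criticalOrbit_le (hlam : 1 < ‖lam‖) (hp0 : p.coeff 0 = 0)
    (hp1 : p.coeff 1 = lam) (hq0 : q.coeff 0 = 0)
    (hk : (fun z : ℂ => p.eval z)^[k] x₀ = 0) :
    ∃ C δ : ℝ, 0 < C ∧ 0 < δ ∧ δ ≤ 1 ∧ ∀ (j : ℕ) (t : ℂ), k ≤ j → ‖lam‖ ^ j * ‖t‖ ≤ δ →
      ‖criticalOrbit lam p q x₀ j t‖ ≤ C * (‖lam‖ ^ j * ‖t‖) := by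
  obtain ⟨K₁, hK₁, hP⟩ := p.exists_norm_sub_taylor_one_le
  obtain ⟨K₂, hK₂, hQ⟩ := q.exists_norm_sub_taylor_zero_le
  obtain ⟨C₀, hC₀, hB⟩ := (orbitPoly lam p q x₀ 0 k).exists_norm_sub_taylor_zero_le
  simp only [hp0, hp1, hq0, orbitPoly_coeff_zero hp0 hq0 hk le_rfl, sub_zero] at hP hQ hB
  set μ := ‖lam‖ with hμ
  have hμ0 : 0 < μ := by linarith
  have hμ1 : 0 < μ - 1 := by linarith
  have hμ2 : 0 < μ ^ 2 - 1 := by nlinarith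
  set P := K₂ * μ / (μ ^ 2 - 1)
  have hP0 : 0 < P := by positivity
  have hPe : P * (μ ^ 2 - 1) = K₂ * μ := by simp only [P]; field_simp
  set M := C₀ + P
  set N := K₁ * (M + 1) ^ 2 / (μ * (μ - 1))
  have hM0 : 0 < M := by positivity
  have hN0 : 0 < N := by positivity
  have hNe : N * (μ * (μ - 1)) = K₁ * (M + 1) ^ 2 := by simp only [N]; field_simp
  have hδ : 1 / (M + N + 1) * (M + N + 1) = 1 := by field_simp
  have hδ0 : 0 < 1 / (M + N + 1) := by positivity
  refine ⟨M + 1, 1 / (M + N + 1), by positivity, by positivity, ?_, ?_⟩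
  · rw [div_le_one (by positivity)]; linarith
  -- The plain bound `M * x`, with `x = μ ^ j * ‖t‖`, is not inductive. The term `N * x` absorbs the
  -- quadratic error of `p`, and `-P * (μ ^ j)⁻¹ ^ 2` absorbs the forcing by `q`; `N` and `P` solve
  -- the resulting equations exactly.
  have key : ∀ (j : ℕ), k ≤ j → ∀ t : ℂ, μ ^ j * ‖t‖ ≤ 1 / (M + N + 1) →
      ‖criticalOrbit lam p q x₀ j t‖ ≤
        (μ ^ j * ‖t‖) * (M + N * (μ ^ j * ‖t‖) - P * (μ ^ j)⁻¹ ^ 2) := by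
    intro j hj
    induction j, hj using Nat.le_induction with
    | base =>
      intro t ht
      have hx : ‖t‖ ≤ μ ^ k * ‖t‖ := norm_le_pow_mul hlam t k
      have ht1 : ‖t‖ ≤ 1 := (hx.trans ht).trans (by
        rw [div_le_one (by positivity)]; linarith)
      have h1 : (μ ^ k)⁻¹ ^ 2 ≤ 1 :=
        pow_le_one₀ (by positivity) (inv_le_one_of_one_le₀ (one_le_pow₀ hlam.le))
      calc _ ≤ C₀ * ‖t‖ := hB t ht1
        _ ≤ C₀ * (μ ^ k * ‖t‖) := by gcongr
        _ ≤ _ := by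
          rw [mul_comm]
          gcongr
          have : 0 ≤ N * (μ ^ k * ‖t‖) := by positivity
          have := mul_le_mul_of_nonneg_left h1 hP0.le
          simp only [M]
          linarith
    | succ j hj ih =>
      intro t ht
      have hx' : μ ^ j * ‖t‖ ≤ μ ^ (j + 1) * ‖t‖ := pow_mul_le_succ hlam t j
      have hx := ih t (hx'.trans ht)
      have ht0 : ‖t‖ ≤ μ ^ j * ‖t‖ := norm_le_pow_mul hlam t j
      have hs : μ ^ (j + 1) * ‖t‖ = μ * (μ ^ j * ‖t‖) := by ring
      rw [hs] at ht hx'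
      have hi : (μ ^ (j + 1))⁻¹ ^ 2 = (μ ^ j)⁻¹ ^ 2 / μ ^ 2 := by
        rw [pow_succ μ j, mul_inv, mul_pow, div_eq_mul_inv, inv_pow μ 2]
      have htj : ‖t / lam ^ j‖ = (μ ^ j * ‖t‖) * (μ ^ j)⁻¹ ^ 2 := by
        rw [norm_div, norm_pow, ← hμ]; field_simp
      rw [hs, hi]
      have htj1 := norm_div_pow_le hlam t j
      set x := μ ^ j * ‖t‖
      set i := (μ ^ j)⁻¹ ^ 2
      have hi0 : 0 ≤ i := by positivity
      have hx0 : 0 ≤ x := by positivity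
      have hxd : x * (M + N + 1) ≤ 1 := by
        refine le_of_le_of_eq ?_ hδ
        exact mul_le_mul_of_nonneg_right (hx'.trans ht) (by positivity)
      have hxM : x * (M + 1) ≤ 1 := le_trans (by gcongr; linarith) hxd
      have hxN : N * x ≤ 1 := by
        rw [mul_comm]
        exact le_trans (by gcongr; linarith) hxd
      have hx1 : x ≤ 1 := le_trans (le_mul_of_one_le_right hx0 (by linarith)) hxd
      have hv : ‖criticalOrbit lam p q x₀ j t‖ ≤ x * (M + 1) := by
        refine hx.trans ?_
        gcongr
        linarith [mul_nonneg hP0.le hi0]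
      have hv1 : ‖criticalOrbit lam p q x₀ j t‖ ≤ 1 := hv.trans hxM
      set v := criticalOrbit lam p q x₀ j t
      have hq := hQ (t / lam ^ j) (htj1.trans (ht0.trans hx1))
      have hp := hP v hv1
      rw [criticalOrbit_succ]
      calc _ = ‖lam * v + (p.eval v - lam * v) + q.eval (t / lam ^ j)‖ := by congr 1; ring
        _ ≤ μ * ‖v‖ + K₁ * ‖v‖ ^ 2 + K₂ * ‖t / lam ^ j‖ := by
          refine norm_add₃_le.trans ?_
          rw [norm_mul]
          gcongr
        _ ≤ μ * (x * (M + N * x - P * i)) + K₁ * (x * (M + 1)) ^ 2 + K₂ * (x * i) := by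
          rw [htj]; gcongr
        _ = μ * x * (M + N * x - P * i) + x ^ 2 * (N * (μ * (μ - 1)))
              + x * i * (P * (μ ^ 2 - 1) / μ) := by
          rw [hNe, hPe]; field_simp
        _ = _ := by field_simp; ring
  intro j t hj ht
  refine (key j hj t ht).trans ?_
  rw [mul_comm]
  have h1 : 0 ≤ μ ^ j * ‖t‖ := by positivity
  gcongr
  have h2 : 0 ≤ P * (μ ^ j)⁻¹ ^ 2 := by positivity
  have h3 : N * (μ ^ j * ‖t‖) ≤ N * (1 / (M + N + 1)) := by gcongr
  have h4 : N * (1 / (M + N + 1)) ≤ 1 := by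
    rw [mul_one_div, div_le_one (by positivity)]; linarith
  linarith

/-- Before leaving a neighbourhood of the saddle, the critical orbit is linear in the fibre
parameter up to a quadratic error. -/
theorem exists_norm_criticalOrbit_sub_le (hlam : 1 < ‖lam‖) (hp0 : p.coeff 0 = 0)
    (hp1 : p.coeff 1 = lam) (hq0 : q.coeff 0 = 0)
    (hk : (fun z : ℂ => p.eval z)^[k] x₀ = 0) :
    ∃ C δ : ℝ, 0 < C ∧ 0 < δ ∧ δ ≤ 1 ∧ ∀ (j : ℕ) (t : ℂ), k ≤ j → ‖lam‖ ^ j * ‖t‖ ≤ δ →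
      ‖criticalOrbit lam p q x₀ j t‖ ≤ C * (‖lam‖ ^ j * ‖t‖) ∧
      ‖criticalOrbit lam p q x₀ j t - (orbitPoly lam p q x₀ 0 j).coeff 1 * t‖ ≤
        C * (‖lam‖ ^ j * ‖t‖) ^ 2 := by
  obtain ⟨C, δ, hC, hδ, hδ1, hA⟩ := exists_norm_criticalOrbit_le hlam hp0 hp1 hq0 hk
  obtain ⟨K₁, hK₁, hP⟩ := p.exists_norm_sub_taylor_one_le
  obtain ⟨K₂, hK₂, hQ⟩ := q.exists_norm_sub_taylor_one_le
  obtain ⟨C₀, hC₀, hB⟩ := (orbitPoly lam p q x₀ 0 k).exists_norm_sub_taylor_one_le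
  simp only [hp0, hp1, hq0, orbitPoly_coeff_zero hp0 hq0 hk le_rfl, sub_zero] at hP hQ hB
  set μ := ‖lam‖ with hμ
  have hμ1 : 0 < μ - 1 := by linarith
  -- Chosen so that `μ * E + K₁ * C ^ 2 + K₂ ≤ E * μ ^ 2`, which closes the induction; `C₀` covers
  -- the base case.
  set E := C₀ + (K₁ * C ^ 2 + K₂) / (μ * (μ - 1)) with hE
  have hE0 : 0 < E := by positivity
  have hE1 : K₁ * C ^ 2 + K₂ ≤ E * (μ * (μ - 1)) := by
    rw [hE, add_mul, div_mul_cancel₀ _ (by positivity)]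
    have : 0 ≤ C₀ * (μ * (μ - 1)) := by positivity
    linarith
  refine ⟨C + E, min δ (1 / C), by positivity, by positivity, (min_le_left _ _).trans hδ1, ?_⟩
  have key : ∀ (j : ℕ), k ≤ j → ∀ t : ℂ, μ ^ j * ‖t‖ ≤ min δ (1 / C) →
      ‖criticalOrbit lam p q x₀ j t - (orbitPoly lam p q x₀ 0 j).coeff 1 * t‖ ≤
        E * (μ ^ j * ‖t‖) ^ 2 := by
    intro j hj
    induction j, hj using Nat.le_induction with
    | base =>
      intro t ht
      have hx := norm_le_pow_mul hlam t k
      refine (hB t (hx.trans (ht.trans ((min_le_left _ _).trans hδ1)))).trans ?_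
      gcongr
      rw [hE]
      linarith [show 0 ≤ (K₁ * C ^ 2 + K₂) / (μ * (μ - 1)) by positivity]
    | succ j hj ih =>
      intro t ht
      have hx' := (pow_mul_le_succ hlam t j).trans ht
      have hx := ih t hx'
      have ht0 : ‖t‖ ≤ μ ^ j * ‖t‖ := norm_le_pow_mul hlam t j
      have hv := hA j t hj (hx'.trans (min_le_left _ _))
      have hv1 : ‖criticalOrbit lam p q x₀ j t‖ ≤ 1 := by
        refine hv.trans ?_
        calc _ ≤ C * (1 / C) := by gcongr; exact hx'.trans (min_le_right _ _)
          _ = 1 := by field_simp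
      have htj := (norm_div_pow_le hlam t j).trans ht0
      have hs : μ ^ (j + 1) * ‖t‖ = μ * (μ ^ j * ‖t‖) := by ring
      rw [hs]
      have hq := hQ (t / lam ^ j) (htj.trans (hx'.trans ((min_le_left _ _).trans hδ1)))
      have hp := hP _ hv1
      set x := μ ^ j * ‖t‖
      set v := criticalOrbit lam p q x₀ j t
      rw [criticalOrbit_succ, orbitPoly_coeff_one_succ hp0 hp1 hq0 hk hj]
      calc _ = ‖lam * (v - (orbitPoly lam p q x₀ 0 j).coeff 1 * t) + (p.eval v - lam * v)
            + (q.eval (t / lam ^ j) - q.coeff 1 * (t / lam ^ j))‖ := by congr 1; ring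
        _ ≤ μ * (E * x ^ 2) + K₁ * (C * x) ^ 2 + K₂ * x ^ 2 := by
          refine norm_add₃_le.trans ?_
          rw [norm_mul]
          have h1 : K₁ * ‖v‖ ^ 2 ≤ K₁ * (C * x) ^ 2 := by gcongr
          have h2 : K₂ * ‖t / lam ^ j‖ ^ 2 ≤ K₂ * x ^ 2 := by gcongr
          have h3 := mul_le_mul_of_nonneg_left hx (norm_nonneg lam)
          linarith
        _ = μ * (E * x ^ 2) + (K₁ * C ^ 2 + K₂) * x ^ 2 := by ring
        _ ≤ μ * (E * x ^ 2) + E * (μ * (μ - 1)) * x ^ 2 := by gcongr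
        _ = _ := by ring
  intro j t hj ht
  have hx0 : 0 ≤ μ ^ j * ‖t‖ := by positivity
  refine ⟨(hA j t hj (ht.trans (min_le_left _ _))).trans ?_, (key j hj t ht).trans ?_⟩ <;>
  · gcongr
    linarith

end Growth

/-! ### Comparison of consecutive rescaled passages under degenerate resonance. -/

section Increment

variable {lam : ℂ} {p q : ℂ[X]} {x₀ : ℂ} {k : ℕ}

theorem contDiff_skewProduct (lam : ℂ) (p q : ℂ[X]) : ContDiff ℝ 1 (skewProduct lam p q) := by
  have h1 : ContDiff ℝ 1 (fun y : ℂ × ℂ => y.1 / lam) := contDiff_fst.div_const _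
  exact h1.prodMk ((p.contDiff_real.comp contDiff_snd).add (q.contDiff_real.comp contDiff_fst))

theorem contDiff_skewProduct_iterate (lam : ℂ) (p q : ℂ[X]) (j : ℕ) :
    ContDiff ℝ 1 (skewProduct lam p q)^[j] := by
  induction j with
  | zero => exact contDiff_id
  | succ j ih =>
    rw [Function.iterate_succ']
    exact (contDiff_skewProduct lam p q).comp ih

/-- A number of steps bounded independently of `n` costs only a constant factor. This handles the
part of a passage spent away from the saddle. -/
theorem exists_lipschitz_iterate (lam : ℂ) (p q : ℂ[X]) (L : ℕ) (R : ℝ) :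
    ∃ K : ℝ, 0 < K ∧ ∀ j ≤ L, ∀ a b : ℂ × ℂ, ‖a‖ ≤ R → ‖b‖ ≤ R →
      ‖(skewProduct lam p q)^[j] a - (skewProduct lam p q)^[j] b‖ ≤ K * ‖a - b‖ := by
  induction L with
  | zero =>
    refine ⟨1, one_pos, fun j hj a b _ _ => ?_⟩
    obtain rfl : j = 0 := by omega
    simp
  | succ L ih =>
    obtain ⟨K, hK, h⟩ := ih
    obtain ⟨M, hM, h'⟩ := exists_lipschitz_on_ball (contDiff_skewProduct_iterate lam p q (L + 1)) R
    refine ⟨K + M, by positivity, fun j hj a b ha hb => ?_⟩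
    have h0 := norm_nonneg (a - b)
    rcases Nat.le_succ_iff.1 hj with hj | rfl
    · exact (h j hj a b ha hb).trans (by nlinarith)
    · exact (h' a b ha hb).trans (by nlinarith)

/-- In the degenerate resonant case the quadratic coefficients of
`t ↦ π₂ F^(j+1)(t / lam, x₀) - π₂ F^j(t, x₀)` stay bounded. -/
theorem IsDegenerateResonant.exists_norm_coeff_le (hlam : 1 < ‖lam‖)
    (hF : IsDegenerateResonant lam p q x₀ k) :
    ∃ m : ℝ, 0 < m ∧ ∀ j, k ≤ j →
      ‖(orbitPoly lam p q x₀ 0 (j + 1)).coeff 2 / lam ^ 2 - (orbitPoly lam p q x₀ 0 j).coeff 2‖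
        ≤ m := by
  obtain ⟨X2, X1, X0, Xm1, Xm2, h, rfl⟩ := hF
  have hl0 : lam ≠ 0 := norm_pos_iff.1 (by linarith)
  have hc : ∀ j, k ≤ j → (orbitPoly lam p q x₀ 0 j).coeff 2 =
      X2 * (lam ^ j) ^ 2 + X0 + Xm1 * (lam ^ j)⁻¹ + Xm2 * ((lam ^ j) ^ 2)⁻¹ := by
    intro j hj
    rw [h 0 j hj]
    have e1 : lam ^ (-2 * ((0 : ℕ) : ℤ) + 2 * (j : ℤ)) = (lam ^ j) ^ 2 := by
      rw [← pow_mul, ← zpow_natCast]; congr 1; push_cast; ring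
    have e2 : lam ^ (-2 * ((0 : ℕ) : ℤ)) = 1 := by simp
    have e3 : lam ^ (-2 * ((0 : ℕ) : ℤ) - (j : ℤ)) = (lam ^ j)⁻¹ := by simp
    have e4 : lam ^ (-2 * ((0 : ℕ) : ℤ) - 2 * (j : ℤ)) = ((lam ^ j) ^ 2)⁻¹ := by
      rw [← pow_mul, ← zpow_natCast, ← zpow_neg]; congr 1; push_cast; ring
    rw [e1, e2, e3, e4]
    ring
  refine ⟨2 * ‖X0‖ + 2 * ‖Xm1‖ + 2 * ‖Xm2‖ + 1, by positivity, fun j hj => ?_⟩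
  have hi : ∀ n : ℕ, ‖(lam ^ n)⁻¹‖ ≤ 1 := fun n => by
    rw [norm_inv, norm_pow]
    exact inv_le_one_of_one_le₀ (one_le_pow₀ hlam.le)
  have hdiff : ∀ m n : ℕ, ‖(lam ^ m)⁻¹ - (lam ^ n)⁻¹‖ ≤ 2 := fun m n =>
    (norm_sub_le _ _).trans (by linarith [hi m, hi n])
  -- The `X2` contributions cancel exactly. An `X1` contribution would grow like `lam ^ j`; this is
  -- where degenerate resonance enters.
  have e : (orbitPoly lam p q x₀ 0 (j + 1)).coeff 2 / lam ^ 2 - (orbitPoly lam p q x₀ 0 j).coeff 2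
      = X0 * ((lam ^ 2)⁻¹ - (lam ^ 0)⁻¹) + Xm1 * ((lam ^ (j + 3))⁻¹ - (lam ^ j)⁻¹)
        + Xm2 * ((lam ^ (2 * j + 4))⁻¹ - (lam ^ (2 * j))⁻¹) := by
    rw [hc j hj, hc (j + 1) (by omega)]
    field_simp
    ring
  rw [e]
  refine norm_add₃_le.trans ?_
  simp only [norm_mul]
  nlinarith [mul_le_mul_of_nonneg_left (hdiff 2 0) (norm_nonneg X0),
    mul_le_mul_of_nonneg_left (hdiff (j + 3) j) (norm_nonneg Xm1),
    mul_le_mul_of_nonneg_left (hdiff (2 * j + 4) (2 * j)) (norm_nonneg Xm2)]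

/-- With `u = lam ^ j`, subtracting the linear and quadratic parts leaves `lam` times the old
remainder plus errors of third order. The `p₂` term comes from factoring `y' ^ 2 - y ^ 2` as `(y' -
y) * (y + y')` and comparing each factor with its linear part in `t`. -/
theorem increment_recursion {u t y y' a a₁ a₂ c c₁ c₂ b p₂ q₂ py py' qs qs' : ℂ}
    (hlam : lam ≠ 0) (hu : u ≠ 0) (ha₁ : a₁ = lam * a + b / u)
    (ha₂ : a₂ = lam * a₁ + b / (u * lam)) (hc₁ : c₁ = lam * c + p₂ * a ^ 2 + q₂ / u ^ 2)
    (hc₂ : c₂ = lam * c₁ + p₂ * a₁ ^ 2 + q₂ / (u * lam) ^ 2) :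
    py' + qs' - (py + qs) - (a₂ / lam - a₁) * t - (c₂ / lam ^ 2 - c₁) * t ^ 2 =
      lam * (y' - y - (a₁ / lam - a) * t - (c₁ / lam ^ 2 - c) * t ^ 2)
        + (py' - py - lam * (y' - y) - p₂ * (y' ^ 2 - y ^ 2))
        + p₂ * ((y' - y - (a₁ / lam - a) * t) * (y + y')
          + (a₁ / lam - a) * t * ((y - a * t) + (y' - a₁ * (t / lam))))
        + ((qs' - b * (t / lam / (u * lam)) - q₂ * (t / lam / (u * lam)) ^ 2)
          - (qs - b * (t / u) - q₂ * (t / u) ^ 2)) := by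
  subst hc₂ ha₂ hc₁ ha₁
  field_simp
  ring

/-- The remainder is multiplied by about `‖lam‖` at each step and is driven by a term of size `‖lam‖
^ j * ‖t‖ ^ 3`. Both rates equal `‖lam‖`, which would produce an extra factor `j`; any `ν > ‖lam‖`
absorbs it. -/
theorem exists_norm_increment_sub_taylor_le (hlam : 1 < ‖lam‖) (hp0 : p.coeff 0 = 0)
    (hp1 : p.coeff 1 = lam) (hq0 : q.coeff 0 = 0)
    (hk : (fun z : ℂ => p.eval z)^[k] x₀ = 0) (hF : IsDegenerateResonant lam p q x₀ k)
    {ν : ℝ} (hν : ‖lam‖ < ν) :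
    ∃ C δ : ℝ, 0 < C ∧ 0 < δ ∧ δ ≤ 1 ∧ ∀ (j : ℕ), k ≤ j → ∀ t : ℂ, ‖lam‖ ^ j * ‖t‖ ≤ δ →
      ‖criticalOrbit lam p q x₀ (j + 1) (t / lam) - criticalOrbit lam p q x₀ j t
          - ((orbitPoly lam p q x₀ 0 (j + 1)).coeff 1 / lam
              - (orbitPoly lam p q x₀ 0 j).coeff 1) * t
          - ((orbitPoly lam p q x₀ 0 (j + 1)).coeff 2 / lam ^ 2
              - (orbitPoly lam p q x₀ 0 j).coeff 2) * t ^ 2‖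
        ≤ C * (ν ^ j * ‖t‖ ^ 3) := by
  have hl0 : lam ≠ 0 := norm_pos_iff.1 (by linarith)
  obtain ⟨C₁, δ₁, hC₁, hδ₁, hδ₁1, hA⟩ := exists_norm_criticalOrbit_sub_le hlam hp0 hp1 hq0 hk
  obtain ⟨K, hK, hP⟩ := p.exists_norm_increment_le_cubic
  obtain ⟨K₂, hK₂, hQ⟩ := q.exists_norm_sub_taylor_two_le
  obtain ⟨m, hm, hM⟩ := hF.exists_norm_coeff_le hlam
  obtain ⟨C₀, hC₀, hB⟩ := ((orbitPoly lam p q x₀ 0 (k + 1)).comp (C lam⁻¹ * X)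
    - orbitPoly lam p q x₀ 0 k).exists_norm_sub_taylor_two_le
  have hg0 : (C lam⁻¹ * X : ℂ[X]).coeff 0 = 0 := by simp
  have hcomp0 : ((orbitPoly lam p q x₀ 0 (k + 1)).comp (C lam⁻¹ * X)).coeff 0 = 0 := by
    rw [coeff_zero_eq_eval_zero, eval_comp]
    simp only [eval_mul, eval_C, eval_X, mul_zero]
    rw [← coeff_zero_eq_eval_zero]
    exact orbitPoly_coeff_zero hp0 hq0 hk (by omega)
  simp only [coeff_sub, hcomp0, orbitPoly_coeff_zero hp0 hq0 hk le_rfl, sub_zero,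
    coeff_one_comp_of_coeff_zero _ hg0, coeff_two_comp_of_coeff_zero _ hg0, eval_sub, eval_comp,
    eval_mul, eval_C, eval_X, coeff_C_mul, coeff_X_one, coeff_X_of_ne_one (show 2 ≠ 1 by norm_num),
    mul_one, mul_zero, zero_add] at hB
  simp only [hp1, hq0, sub_zero] at hP hQ
  set μ := ‖lam‖ with hμ
  have hμ0 : 0 < μ := by linarith
  have hν1 : 1 < ν := hlam.trans hν
  set B := ‖q.coeff 1‖
  set P := ‖p.coeff 2‖
  -- `G - 1` collects the coefficients of `x * ‖r‖` and `S` those of `x * T ^ 2`. Half of the gap `ν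
  -- - μ` pays for the first, by smallness of `x`, and the other half for the second, by the choice
  -- of `E`.
  set G := 4 * K * C₁ ^ 2 + 2 * C₁ * P + 1
  set S := 4 * K * C₁ ^ 2 * (B + m) + 2 * C₁ * P * (m + B) + 2 * K₂
  have hB0 : 0 ≤ B := norm_nonneg _
  have hP0 : 0 ≤ P := norm_nonneg _
  have hG0 : 0 < G := by positivity
  have hS0 : 0 < S := by positivity
  have hνμ : 0 < ν - μ := by linarith
  set E := C₀ + 2 * S / (ν - μ)
  have hE0 : 0 < E := by positivity
  have hE1 : S ≤ E * ((ν - μ) / 2) := by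
    have : 2 * S / (ν - μ) * ((ν - μ) / 2) = S := by field_simp
    have h2 : 0 ≤ C₀ * ((ν - μ) / 2) := by positivity
    simp only [E, add_mul]
    linarith
  refine ⟨E, min (min δ₁ (1 / C₁)) ((ν - μ) / 2 / G), hE0, by positivity,
    ((min_le_left _ _).trans (min_le_left _ _)).trans hδ₁1, ?_⟩
  intro j hj
  induction j, hj using Nat.le_induction with
  | base =>
    intro t ht
    have hx : ‖t‖ ≤ μ ^ k * ‖t‖ := norm_le_pow_mul hlam t k
    have ht1 : ‖t‖ ≤ 1 := hx.trans (ht.trans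
      (((min_le_left _ _).trans (min_le_left _ _)).trans hδ₁1))
    have h1 : (1 : ℝ) ≤ ν ^ k := one_le_pow₀ hν1.le
    calc _ = _ := by
          congr 1
          simp only [criticalOrbit]
          rw [div_eq_inv_mul t lam]
          ring
      _ ≤ C₀ * ‖t‖ ^ 3 := hB t ht1
      _ ≤ E * (ν ^ k * ‖t‖ ^ 3) := by
        gcongr
        · simp only [E]
          linarith [show 0 ≤ 2 * S / (ν - μ) by positivity]
        · exact le_mul_of_one_le_left (by positivity) h1
  | succ j hj ih =>
    intro t ht
    have hx' : μ ^ j * ‖t‖ ≤ _ := (pow_mul_le_succ hlam t j).trans ht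
    have hr := ih t hx'
    have hT : ‖t‖ ≤ μ ^ j * ‖t‖ := norm_le_pow_mul hlam t j
    have hx₁ := (hx'.trans (min_le_left _ _)).trans (min_le_left _ _)
    have hxC : (μ ^ j * ‖t‖) * C₁ ≤ 1 := by
      rw [← le_div_iff₀ hC₁]
      exact (hx'.trans (min_le_left _ _)).trans (min_le_right _ _)
    have hxG : (μ ^ j * ‖t‖) * G ≤ (ν - μ) / 2 := by
      rw [← le_div_iff₀ hG0]
      exact hx'.trans (min_le_right _ _)
    have hx1 := hx₁.trans hδ₁1
    have hxs : ‖lam‖ ^ (j + 1) * ‖t / lam‖ = μ ^ j * ‖t‖ := by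
      rw [norm_div, ← hμ, pow_succ]; field_simp
    obtain ⟨hy, hya⟩ := hA j t hj hx₁
    obtain ⟨hy', hya'⟩ := hA (j + 1) (t / lam) (by omega) (by rw [hxs]; exact hx₁)
    rw [hxs] at hy' hya'
    have hmj := hM j hj
    have hs1 := (norm_div_pow_le hlam t j)
    have hs2 := (norm_div_pow_le hlam t (j + 2))
    rw [show t / lam ^ (j + 2) = t / lam / (lam ^ j * lam) by field_simp; ring] at hs2
    have hq1 := hQ (t / lam ^ j) (hs1.trans (hT.trans hx1))
    have hq2 := hQ (t / lam / (lam ^ j * lam)) (hs2.trans (hT.trans hx1))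
    have hl : ((orbitPoly lam p q x₀ 0 (j + 1)).coeff 1 / lam
              - (orbitPoly lam p q x₀ 0 j).coeff 1) = q.coeff 1 / lam ^ j / lam := by
      rw [orbitPoly_coeff_one_succ hp0 hp1 hq0 hk hj]
      field_simp
      ring
    have hlt : ‖((orbitPoly lam p q x₀ 0 (j + 1)).coeff 1 / lam
              - (orbitPoly lam p q x₀ 0 j).coeff 1) * t‖ ≤ B * (‖t‖ / μ ^ j) := by
      rw [hl, norm_mul, norm_div, norm_div, norm_pow, ← hμ]
      calc B / μ ^ j / μ * ‖t‖ = B * (‖t‖ / μ ^ j) / μ := by ring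
        _ ≤ _ := div_le_self (by positivity) hlam.le
    rw [criticalOrbit_succ lam p q x₀ (j + 1), criticalOrbit_succ lam p q x₀ j t,
      increment_recursion (y := criticalOrbit lam p q x₀ j t)
        (y' := criticalOrbit lam p q x₀ (j + 1) (t / lam)) hl0 (pow_ne_zero j hl0)
        (orbitPoly_coeff_one_succ hp0 hp1 hq0 hk hj)
        (orbitPoly_coeff_one_succ hp0 hp1 hq0 hk (show k ≤ j + 1 by omega))
        (orbitPoly_coeff_two_succ hp0 hp1 hq0 hk hj)
        (orbitPoly_coeff_two_succ hp0 hp1 hq0 hk (show k ≤ j + 1 by omega))]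
    have hpy := hP _ _ (hy.trans (by linarith)) (hy'.trans (by linarith))
    set y := criticalOrbit lam p q x₀ j t
    set y' := criticalOrbit lam p q x₀ (j + 1) (t / lam)
    set l := (orbitPoly lam p q x₀ 0 (j + 1)).coeff 1 / lam - (orbitPoly lam p q x₀ 0 j).coeff 1
    set c := (orbitPoly lam p q x₀ 0 (j + 1)).coeff 2 / lam ^ 2
      - (orbitPoly lam p q x₀ 0 j).coeff 2
    set x := μ ^ j * ‖t‖
    set r := y' - y - l * t - c * t ^ 2 with hrdef
    set T := ‖t‖
    set i := T / μ ^ j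
    have hT0 : 0 ≤ T := norm_nonneg t
    have hx0 : 0 ≤ x := by positivity
    have hi0 : 0 ≤ i := by positivity
    -- The linear part of the increment decays like `T / μ ^ j` while the orbit grows like `μ ^ j *
    -- T`; their product does not depend on `j`.
    have hxi : x * i = T ^ 2 := by
      change μ ^ j * T * (T / μ ^ j) = T ^ 2
      field_simp
    have hct : ‖c * t ^ 2‖ ≤ m * T ^ 2 := by
      rw [norm_mul, norm_pow]; gcongr
    have hdl : ‖y' - y - l * t‖ ≤ m * T ^ 2 + ‖r‖ := by
      rw [show y' - y - l * t = c * t ^ 2 + r by rw [hrdef]; ring]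
      exact (norm_add_le _ _).trans (by gcongr)
    have hd : ‖y' - y‖ ≤ B * i + (m * T ^ 2 + ‖r‖) := by
      rw [show y' - y = l * t + (y' - y - l * t) by ring]
      exact (norm_add_le _ _).trans (add_le_add hlt hdl)
    have hyy : ‖y‖ + ‖y'‖ ≤ 2 * C₁ * x := by linarith
    have hT3 : T ^ 3 ≤ x * T ^ 2 := by
      rw [pow_succ' T 2]; gcongr
    have h2 : ‖p.eval y' - p.eval y - lam * (y' - y) - p.coeff 2 * (y' ^ 2 - y ^ 2)‖ ≤
        4 * K * C₁ ^ 2 * ((B + m) * (x * T ^ 2) + x * ‖r‖) := by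
      refine hpy.trans ?_
      calc K * (‖y‖ + ‖y'‖) ^ 2 * ‖y' - y‖
          ≤ K * (2 * C₁ * x) ^ 2 * (B * i + (m * T ^ 2 + ‖r‖)) := by gcongr
        _ = 4 * K * C₁ ^ 2 * (B * (x * (x * i)) + x * (m * (x * T ^ 2) + x * ‖r‖)) := by ring
        _ ≤ 4 * K * C₁ ^ 2 * (B * (x * T ^ 2) + 1 * (m * (x * T ^ 2) + x * ‖r‖)) := by
          rw [hxi]; gcongr
        _ = _ := by ring
    have h3 : ‖p.coeff 2 * ((y' - y - l * t) * (y + y') + l * t *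
          ((y - (orbitPoly lam p q x₀ 0 j).coeff 1 * t) +
            (y' - (orbitPoly lam p q x₀ 0 (j + 1)).coeff 1 * (t / lam))))‖ ≤
        P * (2 * C₁ * ((m + B) * (x * T ^ 2) + x * ‖r‖)) := by
      rw [norm_mul]
      gcongr
      calc _ ≤ (m * T ^ 2 + ‖r‖) * (2 * C₁ * x) + (B * i) * (C₁ * x ^ 2 + C₁ * x ^ 2) := by
            refine (norm_add_le _ _).trans (add_le_add ?_ ?_)
            · rw [norm_mul]
              gcongr
              exact (norm_add_le _ _).trans hyy
            · rw [norm_mul]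
              exact mul_le_mul hlt ((norm_add_le _ _).trans (add_le_add hya hya'))
                (norm_nonneg _) (by positivity)
        _ = (m * T ^ 2 + ‖r‖) * (2 * C₁ * x) + 2 * C₁ * B * (x * (x * i)) := by ring
        _ = _ := by rw [hxi]; ring
    have h4 : ‖(q.eval (t / lam / (lam ^ j * lam)) - q.coeff 1 * (t / lam / (lam ^ j * lam))
            - q.coeff 2 * (t / lam / (lam ^ j * lam)) ^ 2)
          - (q.eval (t / lam ^ j) - q.coeff 1 * (t / lam ^ j)
            - q.coeff 2 * (t / lam ^ j) ^ 2)‖ ≤ 2 * K₂ * (x * T ^ 2) := by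
      refine (norm_sub_le _ _).trans ?_
      calc _ ≤ K₂ * T ^ 3 + K₂ * T ^ 3 := by
            refine add_le_add (hq2.trans ?_) (hq1.trans ?_) <;> gcongr
        _ ≤ K₂ * (x * T ^ 2) + K₂ * (x * T ^ 2) := by gcongr
        _ = _ := by ring
    have hν0 : 0 < ν := by linarith
    have hxν : x * T ^ 2 ≤ ν ^ j * T ^ 3 := by
      rw [show x * T ^ 2 = μ ^ j * T ^ 3 by simp only [x]; ring]
      gcongr
    have hGR : G * (x * ‖r‖) ≤ (ν - μ) / 2 * ‖r‖ := by
      calc _ = x * G * ‖r‖ := by ring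
        _ ≤ _ := by gcongr
    have hxr : 0 ≤ x * ‖r‖ := by positivity
    calc _ ≤ ‖lam * r‖ + 4 * K * C₁ ^ 2 * ((B + m) * (x * T ^ 2) + x * ‖r‖)
          + P * (2 * C₁ * ((m + B) * (x * T ^ 2) + x * ‖r‖)) + 2 * K₂ * (x * T ^ 2) := by
          refine (norm_add_le _ _).trans (add_le_add ?_ h4)
          exact norm_add₃_le.trans (add_le_add (add_le_add le_rfl h2) h3)
      _ = μ * ‖r‖ + (G - 1) * (x * ‖r‖) + S * (x * T ^ 2) := by
          rw [norm_mul]; simp only [G, S]; ring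
      _ ≤ (μ + (ν - μ) / 2) * ‖r‖ + S * (x * T ^ 2) := by linarith
      _ ≤ (μ + (ν - μ) / 2) * (E * (ν ^ j * T ^ 3))
          + E * ((ν - μ) / 2) * (ν ^ j * T ^ 3) := by gcongr
      _ = _ := by ring

/-- In the degenerate resonant case, replacing `(t, x₀)` by `F(t / lam, x₀)` hardly affects the
orbit as long as it stays near the saddle. -/
theorem exists_norm_increment_criticalOrbit_le (hlam : 1 < ‖lam‖) (hp0 : p.coeff 0 = 0)
    (hp1 : p.coeff 1 = lam) (hq0 : q.coeff 0 = 0)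
    (hk : (fun z : ℂ => p.eval z)^[k] x₀ = 0) (hF : IsDegenerateResonant lam p q x₀ k)
    {ν : ℝ} (hν : ‖lam‖ < ν) :
    ∃ C δ : ℝ, 0 < C ∧ 0 < δ ∧ δ ≤ 1 ∧ ∀ (j : ℕ), k ≤ j → ∀ t : ℂ, ‖lam‖ ^ j * ‖t‖ ≤ δ →
      ‖criticalOrbit lam p q x₀ (j + 1) (t / lam) - criticalOrbit lam p q x₀ j t‖
        ≤ C * (‖t‖ / ‖lam‖ ^ j + ‖t‖ ^ 2 + ν ^ j * ‖t‖ ^ 3) := by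
  have hl0 : lam ≠ 0 := norm_pos_iff.1 (by linarith)
  obtain ⟨m, hm, hM⟩ := hF.exists_norm_coeff_le hlam
  obtain ⟨C, δ, hC, hδ, hδ1, h⟩ :=
    exists_norm_increment_sub_taylor_le hlam hp0 hp1 hq0 hk hF hν
  refine ⟨‖q.coeff 1‖ + m + C, δ, by positivity, hδ, hδ1, fun j hj t ht => ?_⟩
  have h1 := h j hj t ht
  have h2 := hM j hj
  have hl : ((orbitPoly lam p q x₀ 0 (j + 1)).coeff 1 / lam
            - (orbitPoly lam p q x₀ 0 j).coeff 1) = q.coeff 1 / lam ^ j / lam := by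
    rw [orbitPoly_coeff_one_succ hp0 hp1 hq0 hk hj]
    field_simp
    ring
  rw [hl] at h1
  set c := (orbitPoly lam p q x₀ 0 (j + 1)).coeff 2 / lam ^ 2
    - (orbitPoly lam p q x₀ 0 j).coeff 2
  set d := criticalOrbit lam p q x₀ (j + 1) (t / lam) - criticalOrbit lam p q x₀ j t
  have hν0 : 0 < ν := by linarith
  have hi : 0 ≤ ‖t‖ / ‖lam‖ ^ j := by positivity
  have hT : 0 ≤ ‖t‖ ^ 2 := by positivity
  have hT3 : 0 ≤ ν ^ j * ‖t‖ ^ 3 := by positivity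
  calc ‖d‖ = ‖q.coeff 1 / lam ^ j / lam * t + c * t ^ 2
        + (d - q.coeff 1 / lam ^ j / lam * t - c * t ^ 2)‖ := by congr 1; ring
    _ ≤ ‖q.coeff 1‖ * (‖t‖ / ‖lam‖ ^ j) + m * ‖t‖ ^ 2 + C * (ν ^ j * ‖t‖ ^ 3) := by
      refine norm_add₃_le.trans (add_le_add (add_le_add ?_ ?_) h1)
      · rw [norm_mul, norm_div, norm_div, norm_pow]
        calc _ = ‖q.coeff 1‖ * (‖t‖ / ‖lam‖ ^ j) / ‖lam‖ := by ring
          _ ≤ _ := div_le_self (by positivity) hlam.le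
      · rw [norm_mul, norm_pow]; gcongr
    _ ≤ _ := by nlinarith [norm_nonneg (q.coeff 1), mul_nonneg hm.le hi, mul_nonneg hm.le hT3,
        mul_nonneg hC.le hi, mul_nonneg hC.le hT, mul_nonneg (norm_nonneg (q.coeff 1)) hT,
        mul_nonneg (norm_nonneg (q.coeff 1)) hT3]

theorem criticalOrbit_add (lam : ℂ) (p q : ℂ[X]) (x₀ : ℂ) (j L : ℕ) (t : ℂ) :
    criticalOrbit lam p q x₀ (j + L) t =
      ((skewProduct lam p q)^[L] (t / lam ^ j, criticalOrbit lam p q x₀ j t)).2 := by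
  rw [criticalOrbit_eq_snd, add_comm, Function.iterate_add_apply,
    skewProduct_iterate_critical lam p q x₀ j t]

/-- In the degenerate resonant case the functions `w ↦ π₂ F^n(w / lam ^ n, x₀)` converge
geometrically, at a rate arbitrarily close to `‖lam‖ ^ (-2n)`. -/
theorem exists_norm_rescaled_succ_sub_le (hlam : 1 < ‖lam‖) (hp0 : p.coeff 0 = 0)
    (hp1 : p.coeff 1 = lam) (hq0 : q.coeff 0 = 0)
    (hk : (fun z : ℂ => p.eval z)^[k] x₀ = 0) (hF : IsDegenerateResonant lam p q x₀ k)
    {ν : ℝ} (hν : ‖lam‖ < ν) (w : ℂ) :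
    ∃ (C : ℝ) (N : ℕ), 0 < C ∧ ∀ n, N ≤ n →
      ‖criticalOrbit lam p q x₀ (n + 1) (w / lam ^ (n + 1))
        - criticalOrbit lam p q x₀ n (w / lam ^ n)‖ ≤ C * (ν / ‖lam‖ ^ 3) ^ n := by
  have hl0 : lam ≠ 0 := norm_pos_iff.1 (by linarith)
  obtain ⟨C₁, δ₁, hC₁, hδ₁, hδ₁1, hA⟩ := exists_norm_criticalOrbit_le hlam hp0 hp1 hq0 hk
  obtain ⟨C, δ, hC, hδ, hδ1, hD⟩ :=
    exists_norm_increment_criticalOrbit_le hlam hp0 hp1 hq0 hk hF hν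
  -- All but the last `L` steps of a passage obey the estimates near the saddle, and `L` does not
  -- depend on `n`.
  obtain ⟨L, hL⟩ := pow_unbounded_of_one_lt (‖w‖ / min δ₁ δ) hlam
  obtain ⟨K, hK, hLip⟩ := exists_lipschitz_iterate lam p q L (1 + C₁)
  have hν0 : 0 < ν := by linarith
  set μ := ‖lam‖ with hμ
  have hμ0 : 0 < μ := by linarith
  refine ⟨K * ((2 + C) * (‖w‖ * μ ^ L + ‖w‖ ^ 2 + ‖w‖ ^ 3) + 1), k + L, by positivity,
    fun n hn => ?_⟩
  obtain ⟨j, rfl⟩ : ∃ j, n = j + L := ⟨n - L, by omega⟩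
  have hj : k ≤ j := by omega
  set t := w / lam ^ (j + L) with ht
  have hT : ‖t‖ = ‖w‖ / μ ^ (j + L) := by rw [ht, norm_div, norm_pow]
  have hx : μ ^ j * ‖t‖ ≤ min δ₁ δ := by
    rw [hT, pow_add]
    rw [div_lt_iff₀ (by positivity)] at hL
    rw [show μ ^ j * (‖w‖ / (μ ^ j * μ ^ L)) = ‖w‖ / μ ^ L by field_simp,
      div_le_iff₀ (by positivity)]
    linarith
  have hx1 : ‖t‖ ≤ 1 := (norm_le_pow_mul hlam t j).trans
    (hx.trans ((min_le_left _ _).trans hδ₁1))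
  have htl : w / lam ^ (j + L + 1) = t / lam := by rw [ht, pow_succ, div_div]
  have hxs : ‖lam‖ ^ (j + 1) * ‖t / lam‖ = μ ^ j * ‖t‖ := by
    rw [norm_div, ← hμ, pow_succ]; field_simp
  have hbd : ∀ {y s : ℂ} (j : ℕ), ‖y‖ ≤ C₁ * (μ ^ j * ‖s‖) → μ ^ j * ‖s‖ ≤ δ₁ →
      ‖s‖ ≤ 1 → ‖((s / lam ^ j, y) : ℂ × ℂ)‖ ≤ 1 + C₁ := by
    intro y s j h1 h2 h3
    refine max_le ?_ ?_
    · exact (norm_div_pow_le hlam s j).trans (by linarith)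
    · refine h1.trans ?_
      nlinarith
  have hx' := hx.trans (min_le_left _ _)
  have hy := hA j t hj hx'
  have hy' := hA (j + 1) (t / lam) (by omega) (by rw [hxs]; exact hx')
  have hd := hD j hj t (hx.trans (min_le_right _ _))
  rw [htl, add_right_comm, criticalOrbit_add lam p q x₀ (j + 1) L (t / lam),
    criticalOrbit_add lam p q x₀ j L t, ← Prod.snd_sub]
  refine (norm_snd_le _).trans ((hLip L le_rfl _ _ (hbd (j + 1) hy' (by rw [hxs]; exact hx')
    (by simpa using (norm_div_pow_le hlam t 1).trans hx1)) (hbd j hy hx' hx1)).trans ?_)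
  rw [mul_assoc]
  gcongr
  set n := j + L with hn'
  have hμn : 0 < μ ^ n := by positivity
  have hθ : (ν / μ ^ 3) ^ n = ν ^ n / (μ ^ n) ^ 3 := by
    rw [div_pow, ← pow_mul, ← pow_mul, mul_comm]
  -- The linear and quadratic contributions are both of order `μ ^ (-2n)`, which the cubic rate
  -- dominates because `μ ≤ ν`.
  have hθ2 : 1 / (μ ^ n) ^ 2 ≤ (ν / μ ^ 3) ^ n := by
    rw [hθ, show 1 / (μ ^ n) ^ 2 = μ ^ n / (μ ^ n) ^ 3 by field_simp]
    gcongr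
  have hS : ‖t‖ / μ ^ j + ‖t‖ ^ 2 + ν ^ j * ‖t‖ ^ 3 ≤
      (‖w‖ * μ ^ L + ‖w‖ ^ 2 + ‖w‖ ^ 3) * (ν / μ ^ 3) ^ n := by
    rw [add_mul, add_mul]
    refine add_le_add (add_le_add ?_ ?_) ?_
    · calc ‖t‖ / μ ^ j = ‖w‖ * μ ^ L * (1 / (μ ^ n) ^ 2) := by
            rw [hT, hn', pow_add]; field_simp
        _ ≤ _ := by gcongr
    · calc ‖t‖ ^ 2 = ‖w‖ ^ 2 * (1 / (μ ^ n) ^ 2) := by rw [hT]; field_simp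
        _ ≤ _ := by gcongr
    · calc ν ^ j * ‖t‖ ^ 3 ≤ ν ^ n * ‖t‖ ^ 3 := by
            gcongr
            · linarith
            · omega
        _ = _ := by rw [hT, hθ]; field_simp
  have hS0 : 0 ≤ ‖t‖ ^ 2 + ν ^ j * ‖t‖ ^ 3 := by positivity
  have hS1 : 0 ≤ ‖t‖ / μ ^ j := by positivity
  have hS2 : (2 + C) * (‖t‖ / μ ^ j + ‖t‖ ^ 2 + ν ^ j * ‖t‖ ^ 3) ≤
      ((2 + C) * (‖w‖ * μ ^ L + ‖w‖ ^ 2 + ‖w‖ ^ 3) + 1) * (ν / μ ^ 3) ^ n := by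
    have h0 : 0 ≤ (ν / μ ^ 3) ^ n := by positivity
    rw [add_mul _ (1 : ℝ), mul_assoc (2 + C) _ ((ν / μ ^ 3) ^ n), one_mul]
    exact (mul_le_mul_of_nonneg_left hS (by positivity)).trans (by linarith)
  refine le_trans (max_le ?_ ?_) hS2
  · have h1 : ‖t / lam / lam ^ (j + 1)‖ ≤ ‖t‖ / μ ^ j := by
      rw [div_div, norm_div, norm_mul, norm_pow, ← hμ]
      gcongr
      calc μ ^ j ≤ μ ^ (j + 1) := pow_le_pow_right₀ hlam.le (by omega)
        _ ≤ _ := le_mul_of_one_le_left (by positivity) hlam.le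
    have h2 : ‖t / lam ^ j‖ = ‖t‖ / μ ^ j := by rw [norm_div, norm_pow]
    refine (norm_sub_le _ _).trans ?_
    change ‖t / lam / lam ^ (j + 1)‖ + ‖t / lam ^ j‖ ≤ _
    nlinarith [mul_nonneg hC.le hS1, mul_nonneg hC.le hS0]
  · refine hd.trans ?_
    gcongr
    linarith

end Increment

/-! ### Rigidity of backward orbits at the repelling fixed point. -/

section BackwardOrbits

variable {lam : ℂ} {p : ℂ[X]}

/-- Backward orbits of `p` tending to the repelling fixed point `0` are determined by their
asymptotics. -/
theorem backward_orbit_unique (hp1 : p.coeff 1 = lam) {x x' : ℕ → ℂ}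
    (hx : ∀ l, p.eval (x (l + 1)) = x l) (hx' : ∀ l, p.eval (x' (l + 1)) = x' l)
    (hx0 : Tendsto x atTop (𝓝 0)) (hx0' : Tendsto x' atTop (𝓝 0)) {C η : ℝ} (hη : 0 < η)
    (hημ : η * ‖lam‖ < 1) (h : ∀ᶠ l in atTop, ‖x l - x' l‖ ≤ C * η ^ l) (l : ℕ) :
    x l = x' l := by
  obtain ⟨K, hK, hP⟩ := p.exists_norm_increment_le
  rw [hp1] at hP
  obtain ⟨ν, hν, hνη⟩ := exists_between ((lt_div_iff₀' hη).2 hημ)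
  have hν0 : 0 < ν := (norm_nonneg _).trans_lt hν
  rw [lt_div_iff₀' hη] at hνη
  have hsmall : ∀ᶠ l in atTop, ‖x l‖ ≤ 1 ∧ ‖x' l‖ ≤ 1 ∧ K * (‖x l‖ + ‖x' l‖) ≤ ν - ‖lam‖ := by
    have e1 := hx0.norm
    have e2 := hx0'.norm
    rw [norm_zero] at e1 e2
    have e3 := (e1.add e2).const_mul K
    rw [add_zero, mul_zero] at e3
    filter_upwards [e1.eventually (ge_mem_nhds one_pos), e2.eventually (ge_mem_nhds one_pos),
      e3.eventually (ge_mem_nhds (show 0 < ν - ‖lam‖ by linarith))] with l h1 h2 h3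
    exact ⟨h1, h2, h3⟩
  obtain ⟨L, hL⟩ := eventually_atTop.1 (hsmall.and h)
  have step : ∀ l, L ≤ l → ‖x l - x' l‖ ≤ ν * ‖x (l + 1) - x' (l + 1)‖ := by
    intro l hl
    obtain ⟨⟨h1, h2, h3⟩, -⟩ := hL (l + 1) (by omega)
    have h4 := hP _ _ h2 h1
    rw [hx, hx'] at h4
    calc _ = ‖lam * (x (l + 1) - x' (l + 1))
          + (x l - x' l - lam * (x (l + 1) - x' (l + 1)))‖ := by congr 1; ring
      _ ≤ ‖lam‖ * ‖x (l + 1) - x' (l + 1)‖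
          + K * (‖x' (l + 1)‖ + ‖x (l + 1)‖) * ‖x (l + 1) - x' (l + 1)‖ := by
        refine (norm_add_le _ _).trans (add_le_add ?_ h4)
        rw [norm_mul]
      _ ≤ ‖lam‖ * ‖x (l + 1) - x' (l + 1)‖ + (ν - ‖lam‖) * ‖x (l + 1) - x' (l + 1)‖ := by
        rw [add_comm ‖x' (l + 1)‖]; gcongr
      _ = _ := by ring
  have iter : ∀ l, L ≤ l → ∀ m, ‖x l - x' l‖ ≤ ν ^ m * ‖x (l + m) - x' (l + m)‖ := by
    intro l hl m
    induction m with
    | zero => simp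
    | succ m ih =>
      refine ih.trans ?_
      rw [pow_succ, mul_assoc]
      gcongr
      exact step (l + m) (by omega)
  have far : ∀ l, L ≤ l → x l = x' l := by
    intro l hl
    have hle : ∀ m, ‖x l - x' l‖ ≤ C * η ^ l * (η * ν) ^ m := by
      intro m
      refine (iter l hl m).trans ?_
      calc _ ≤ ν ^ m * (C * η ^ (l + m)) := by gcongr; exact (hL (l + m) (by omega)).2
        _ = _ := by rw [pow_add, mul_pow]; ring
    have hlim : Tendsto (fun m : ℕ => C * η ^ l * (η * ν) ^ m) atTop (𝓝 (C * η ^ l * 0)) :=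
      (tendsto_pow_atTop_nhds_zero_of_lt_one (by positivity) hνη).const_mul _
    rw [mul_zero] at hlim
    have := ge_of_tendsto' hlim hle
    exact sub_eq_zero.1 (norm_le_zero_iff.1 this)
  have back : ∀ (y : ℕ → ℂ), (∀ l, p.eval (y (l + 1)) = y l) → ∀ m,
      (fun z => p.eval z)^[m] (y (l + m)) = y l := by
    intro y hy m
    induction m with
    | zero => rfl
    | succ m ih => rw [Function.iterate_succ_apply, ← add_assoc, hy, ih]
  -- Agreement far back propagates to every index by iterating `p` forward.
  rw [← back x hx L, ← back x' hx' L, far (l + L) (by omega)]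

/-- Backward orbits of `p` tending to the repelling fixed point `0` are asymptotic to
`ζ / lam ^ l`. -/
theorem backward_orbit_asymptotic (hlam : 1 < ‖lam‖) (hp0 : p.coeff 0 = 0)
    (hp1 : p.coeff 1 = lam) {x : ℕ → ℂ} (hx : ∀ l, p.eval (x (l + 1)) = x l)
    (hx0 : Tendsto x atTop (𝓝 0)) :
    ∃ (ζ : ℂ) (C η : ℝ), 0 < C ∧ 0 < η ∧ η * ‖lam‖ < 1 ∧
      ∀ᶠ l in atTop, ‖x l - ζ / lam ^ l‖ ≤ C * η ^ l := by
  have hl0 : lam ≠ 0 := norm_pos_iff.1 (by linarith)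
  obtain ⟨K, hK, hP⟩ := p.exists_norm_sub_taylor_one_le
  simp only [hp0, hp1, sub_zero] at hP
  set μ := ‖lam‖ with hμ
  have hμ0 : 0 < μ := by linarith
  -- The inequality `ϑ < μ` gives the decay `ϑ ^ (-m)`; `ϑ ^ 2 > μ` makes the quadratic errors of
  -- `lam ^ m * x (L + m)` summable.
  obtain ⟨ϑ, h1ϑ, hϑμ⟩ := exists_between (show √μ < μ by
    rw [Real.sqrt_lt' hμ0]; nlinarith)
  have hϑ0 : 0 < ϑ := (Real.sqrt_nonneg _).trans_lt h1ϑ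
  have hϑ2 : μ < ϑ ^ 2 := (Real.sqrt_lt' hϑ0).1 h1ϑ
  have hϑ1 : 1 < ϑ := by nlinarith
  have hsmall : ∀ᶠ l in atTop, ‖x l‖ ≤ 1 ∧ K * ‖x l‖ ≤ μ - ϑ := by
    have e1 := hx0.norm
    rw [norm_zero] at e1
    have e3 := e1.const_mul K
    rw [mul_zero] at e3
    filter_upwards [e1.eventually (ge_mem_nhds one_pos),
      e3.eventually (ge_mem_nhds (show 0 < μ - ϑ by linarith))] with l h1 h3
    exact ⟨h1, h3⟩
  obtain ⟨L, hL⟩ := eventually_atTop.1 hsmall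
  have decay : ∀ m, ‖x (L + m)‖ ≤ 1 / ϑ ^ m := by
    intro m
    induction m with
    | zero => simpa using (hL L le_rfl).1
    | succ m ih =>
      obtain ⟨h1, h2⟩ := hL (L + (m + 1)) (by omega)
      have h3 := hP _ h1
      rw [← add_assoc, hx, add_assoc] at h3
      set y := x (L + (m + 1))
      have h4 : ϑ * ‖y‖ ≤ ‖x (L + m)‖ := by
        have h5 : ‖lam * y‖ ≤ ‖x (L + m)‖ + ‖x (L + m) - lam * y‖ := by
          rw [show lam * y = x (L + m) - (x (L + m) - lam * y) by ring]
          refine (norm_sub_le _ _).trans (le_of_eq ?_)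
          congr 2; ring
        rw [norm_mul, ← hμ] at h5
        have h6 : K * ‖y‖ ^ 2 ≤ (μ - ϑ) * ‖y‖ := by
          rw [pow_two, ← mul_assoc]; gcongr
        linarith
      rw [pow_succ, ← div_div, le_div_iff₀ hϑ0]
      linarith
  set r := μ / ϑ ^ 2
  have hr1 : r < 1 := (div_lt_one (by positivity)).2 hϑ2
  set g : ℕ → ℂ := fun m => lam ^ m * x (L + m)
  have hg : ∀ m, dist (g m) (g (m + 1)) ≤ K * r ^ m := by
    intro m
    have h3 := hP _ (hL (L + m + 1) (by omega)).1
    rw [hx] at h3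
    calc dist (g m) (g (m + 1)) = ‖lam ^ m * (x (L + m) - lam * x (L + m + 1))‖ := by
          rw [dist_eq_norm]; congr 1; simp only [g, pow_succ, ← add_assoc]; ring
      _ ≤ μ ^ m * (K * (1 / ϑ ^ m) ^ 2) := by
          rw [norm_mul, norm_pow]
          gcongr
          refine h3.trans ?_
          gcongr
          refine (decay (m + 1)).trans ?_
          gcongr
          · exact hϑ1.le
          · omega
      _ = _ := by simp only [r, div_pow]; field_simp; ring
  obtain ⟨G, hG⟩ := cauchySeq_tendsto_of_complete (cauchySeq_of_le_geometric r K hr1 hg)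
  have hdist := dist_le_of_le_geometric_of_tendsto r K hr1 hg hG
  have h1r : 0 < 1 - r := by linarith
  refine ⟨G * lam ^ L, K / (1 - r) * (ϑ ^ 2) ^ L, 1 / ϑ ^ 2, by positivity, by positivity, ?_, ?_⟩
  · rw [one_div_mul_eq_div]; exact hr1
  · filter_upwards [eventually_ge_atTop L] with l hl
    obtain ⟨m, rfl⟩ := Nat.exists_eq_add_of_le hl
    have h2 : x (L + m) - G * lam ^ L / lam ^ (L + m) = (g m - G) / lam ^ m := by
      simp only [g, pow_add]; field_simp
    have h3 := hdist m
    rw [dist_eq_norm] at h3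
    rw [h2, norm_div, norm_pow, ← hμ, div_le_iff₀ (by positivity)]
    refine h3.trans (le_of_eq ?_)
    simp only [r, div_pow, pow_add, one_pow]
    field_simp

end BackwardOrbits

/-! ### The limit function and its functional equation. -/

section Limit

variable {lam : ℂ} {p q : ℂ[X]} {x₀ : ℂ} {k : ℕ}

/-- The limit of the functions `w ↦ π₂ F^n(w / lam ^ n, x₀)`, with a rate of convergence. -/
theorem exists_rescaled_limit (hlam : 1 < ‖lam‖) (hp0 : p.coeff 0 = 0)
    (hp1 : p.coeff 1 = lam) (hq0 : q.coeff 0 = 0)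
    (hk : (fun z : ℂ => p.eval z)^[k] x₀ = 0) (hF : IsDegenerateResonant lam p q x₀ k)
    {ν : ℝ} (hν : ‖lam‖ < ν) (hν3 : ν < ‖lam‖ ^ 3) :
    ∃ h : ℂ → ℂ, ∀ w, ∃ (C : ℝ) (N : ℕ), 0 < C ∧ ∀ n, N ≤ n →
      ‖criticalOrbit lam p q x₀ n (w / lam ^ n) - h w‖ ≤ C * (ν / ‖lam‖ ^ 3) ^ n := by
  have main : ∀ w, ∃ a : ℂ, ∃ (C : ℝ) (N : ℕ), 0 < C ∧ ∀ n, N ≤ n →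
      ‖criticalOrbit lam p q x₀ n (w / lam ^ n) - a‖ ≤ C * (ν / ‖lam‖ ^ 3) ^ n := by
    intro w
    obtain ⟨C, N, hC, h⟩ := exists_norm_rescaled_succ_sub_le hlam hp0 hp1 hq0 hk hF hν w
    set θ := ν / ‖lam‖ ^ 3
    have hμ0 : 0 < ‖lam‖ := by linarith
    have hν0 : 0 < ν := by linarith
    have hθ0 : 0 < θ := by positivity
    have hθ1 : θ < 1 := (div_lt_one (by positivity)).2 hν3
    set f : ℕ → ℂ := fun m => criticalOrbit lam p q x₀ (N + m) (w / lam ^ (N + m))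
    have hf : ∀ m, dist (f m) (f (m + 1)) ≤ (C * θ ^ N) * θ ^ m := by
      intro m
      rw [dist_comm, dist_eq_norm]
      refine (h (N + m) (by omega)).trans (le_of_eq ?_)
      rw [pow_add]; ring
    obtain ⟨a, ha⟩ := cauchySeq_tendsto_of_complete (cauchySeq_of_le_geometric θ _ hθ1 hf)
    have hdist := dist_le_of_le_geometric_of_tendsto θ _ hθ1 hf ha
    have h1θ : 0 < 1 - θ := by linarith
    refine ⟨a, C / (1 - θ), N, by positivity, fun n hn => ?_⟩
    obtain ⟨m, rfl⟩ := Nat.exists_eq_add_of_le hn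
    have := hdist m
    rw [dist_eq_norm] at this
    refine this.trans (le_of_eq ?_)
    rw [pow_add]; ring
  choose h hh using main
  exact ⟨h, hh⟩

theorem tendsto_of_norm_sub_le_geometric {u : ℕ → ℂ} {a : ℂ} {C θ : ℝ} {N : ℕ} (hθ0 : 0 ≤ θ)
    (hθ1 : θ < 1) (h : ∀ n, N ≤ n → ‖u n - a‖ ≤ C * θ ^ n) : Tendsto u atTop (𝓝 a) := by
  rw [tendsto_iff_norm_sub_tendsto_zero]
  have hlim : Tendsto (fun n : ℕ => C * θ ^ n) atTop (𝓝 (C * 0)) :=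
    (tendsto_pow_atTop_nhds_zero_of_lt_one hθ0 hθ1).const_mul _
  rw [mul_zero] at hlim
  exact squeeze_zero' (Eventually.of_forall fun _ => norm_nonneg _)
    (eventually_atTop.2 ⟨N, h⟩) hlim

theorem tendsto_div_pow (hlam : 1 < ‖lam‖) (w : ℂ) :
    Tendsto (fun n : ℕ => w / lam ^ n) atTop (𝓝 0) := by
  have h : Tendsto (fun n : ℕ => w * lam⁻¹ ^ n) atTop (𝓝 (w * 0)) :=
    (tendsto_pow_atTop_nhds_zero_of_norm_lt_one (by
      rw [norm_inv]; exact inv_lt_one_of_one_lt₀ hlam)).const_mul w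
  simpa [div_eq_mul_inv] using h

/-- One more step of `F` at parameter `lam * w` applies `p` and adds `q` at `w / lam ^ (2n)`, and
this last term tends to `0`. -/
theorem rescaled_limit_mul (hlam : 1 < ‖lam‖) (hq0 : q.coeff 0 = 0) {h : ℂ → ℂ}
    (hh : ∀ w, Tendsto (fun n => criticalOrbit lam p q x₀ n (w / lam ^ n)) atTop (𝓝 (h w)))
    (w : ℂ) : h (lam * w) = p.eval (h w) := by
  have hl0 : lam ≠ 0 := norm_pos_iff.1 (by linarith)
  have h1 := (hh (lam * w)).comp (tendsto_add_atTop_nat 1)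
  have h2 : Tendsto (fun n => p.eval (criticalOrbit lam p q x₀ n (w / lam ^ n))
      + q.eval (w / lam ^ n / lam ^ n)) atTop (𝓝 (p.eval (h w) + q.eval 0)) := by
    refine ((p.continuous.tendsto _).comp (hh w)).add ((q.continuous.tendsto _).comp ?_)
    have h3 := tendsto_div_pow (lam := lam ^ 2) (by rw [norm_pow]; nlinarith) w
    refine h3.congr fun n => ?_
    rw [div_div, ← mul_pow, pow_two]
  rw [← coeff_zero_eq_eval_zero, hq0, add_zero] at h2
  refine tendsto_nhds_unique (h1.congr fun n => ?_) h2
  simp only [Function.comp]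
  rw [criticalOrbit_succ, pow_succ', mul_div_mul_left _ _ hl0]

/-- The normalised coefficients have increments forming a geometric series of ratio `lam ^ (-2)`, so
they are computed in closed form. -/
theorem exists_tendsto_coeff_one (hlam : 1 < ‖lam‖) (hp0 : p.coeff 0 = 0)
    (hp1 : p.coeff 1 = lam) (hq0 : q.coeff 0 = 0)
    (hk : (fun z : ℂ => p.eval z)^[k] x₀ = 0) :
    ∃ A : ℂ, Tendsto (fun n => (orbitPoly lam p q x₀ 0 n).coeff 1 / lam ^ n) atTop (𝓝 A) := by
  have hl0 : lam ≠ 0 := norm_pos_iff.1 (by linarith)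
  have hl2 : 1 - lam ^ 2 ≠ 0 := by
    intro h
    have : ‖lam ^ 2‖ = 1 := by rw [← sub_eq_zero.1 h, norm_one]
    rw [norm_pow] at this
    nlinarith
  set B := q.coeff 1 * lam / (1 - lam ^ 2)
  refine ⟨(orbitPoly lam p q x₀ 0 k).coeff 1 / lam ^ k - B / (lam ^ 2) ^ k, ?_⟩
  have key : ∀ n, k ≤ n → (orbitPoly lam p q x₀ 0 n).coeff 1 / lam ^ n =
      ((orbitPoly lam p q x₀ 0 k).coeff 1 / lam ^ k - B / (lam ^ 2) ^ k) + B / (lam ^ 2) ^ n := by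
    intro n hn
    induction n, hn using Nat.le_induction with
    | base => ring
    | succ n hn ih =>
      rw [orbitPoly_coeff_one_succ hp0 hp1 hq0 hk hn]
      have h1 : (lam * (orbitPoly lam p q x₀ 0 n).coeff 1 + q.coeff 1 / lam ^ n) / lam ^ (n + 1)
          = (orbitPoly lam p q x₀ 0 n).coeff 1 / lam ^ n
            + q.coeff 1 / (lam * (lam ^ 2) ^ n) := by
        rw [pow_succ, ← pow_mul, mul_comm 2 n, pow_mul]; field_simp
      rw [h1, ih, pow_succ]
      simp only [B]
      field_simp
      ring
  have hlim := (tendsto_div_pow (lam := lam ^ 2) (by rw [norm_pow]; nlinarith) B).const_add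
    ((orbitPoly lam p q x₀ 0 k).coeff 1 / lam ^ k - B / (lam ^ 2) ^ k)
  rw [add_zero] at hlim
  refine hlim.congr' ?_
  filter_upwards [eventually_ge_atTop k] with n hn
  rw [key n hn]

/-- At `t = w / lam ^ n` the quantity `‖lam‖ ^ n * ‖t‖` equals `‖w‖`, so the growth estimates hold
on a fixed ball for all `n ≥ k` and pass to the limit. -/
theorem rescaled_limit_near_zero (hlam : 1 < ‖lam‖) (hp0 : p.coeff 0 = 0)
    (hp1 : p.coeff 1 = lam) (hq0 : q.coeff 0 = 0)
    (hk : (fun z : ℂ => p.eval z)^[k] x₀ = 0) {h : ℂ → ℂ}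
    (hh : ∀ w, Tendsto (fun n => criticalOrbit lam p q x₀ n (w / lam ^ n)) atTop (𝓝 (h w))) :
    ∃ (A : ℂ) (C δ : ℝ), 0 < C ∧ 0 < δ ∧ ∀ w, ‖w‖ ≤ δ →
      ‖h w‖ ≤ C * ‖w‖ ∧ ‖h w - A * w‖ ≤ C * ‖w‖ ^ 2 := by
  have hl0 : lam ≠ 0 := norm_pos_iff.1 (by linarith)
  obtain ⟨C, δ, hC, hδ, -, hA⟩ := exists_norm_criticalOrbit_sub_le hlam hp0 hp1 hq0 hk
  obtain ⟨A, hA'⟩ := exists_tendsto_coeff_one (x₀ := x₀) hlam hp0 hp1 hq0 hk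
  refine ⟨A, C, δ, hC, hδ, fun w hw => ?_⟩
  have hs : ∀ n : ℕ, ‖lam‖ ^ n * ‖w / lam ^ n‖ = ‖w‖ := fun n => by
    rw [norm_div, norm_pow]
    exact mul_div_cancel₀ _ (pow_ne_zero _ (norm_ne_zero_iff.2 hl0))
  constructor
  · refine le_of_tendsto (hh w).norm ?_
    filter_upwards [eventually_ge_atTop k] with n hn
    have := (hA n (w / lam ^ n) hn (by rw [hs]; exact hw)).1
    rwa [hs] at this
  · refine le_of_tendsto ((hh w).sub (hA'.mul_const w)).norm ?_
    filter_upwards [eventually_ge_atTop k] with n hn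
    have := (hA n (w / lam ^ n) hn (by rw [hs]; exact hw)).2
    rw [hs] at this
    rwa [div_mul_eq_mul_div, mul_div_assoc]

/-- If the limit `h` of `w ↦ π₂ F^n(w / lam ^ n, x₀)` is not identically zero then every backward
orbit tending to `0` has the form `h (w / lam ^ l)`. -/
theorem exists_rescaled_limit_eq (hlam : 1 < ‖lam‖) (hp0 : p.coeff 0 = 0)
    (hp1 : p.coeff 1 = lam) (hq0 : q.coeff 0 = 0)
    (hk : (fun z : ℂ => p.eval z)^[k] x₀ = 0) {h : ℂ → ℂ}
    (hh : ∀ w, Tendsto (fun n => criticalOrbit lam p q x₀ n (w / lam ^ n)) atTop (𝓝 (h w)))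
    {w₀ : ℂ} (hw₀ : h w₀ ≠ 0) {x : ℕ → ℂ} (hx : ∀ l, p.eval (x (l + 1)) = x l)
    (hx0 : Tendsto x atTop (𝓝 0)) : ∃ w, ∀ l, h (w / lam ^ l) = x l := by
  have hl0 : lam ≠ 0 := norm_pos_iff.1 (by linarith)
  obtain ⟨A, C, δ, hC, hδ, hA⟩ := rescaled_limit_near_zero hlam hp0 hp1 hq0 hk hh
  have hback : ∀ w l, p.eval (h (w / lam ^ (l + 1))) = h (w / lam ^ l) := by
    intro w l
    rw [← rescaled_limit_mul hlam hq0 hh, pow_succ', ← mul_div_assoc, mul_div_mul_left _ _ hl0]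
  have hsm : ∀ w, ∀ᶠ l : ℕ in atTop, ‖w / lam ^ l‖ ≤ δ := by
    intro w
    have := (tendsto_div_pow hlam w).norm
    rw [norm_zero] at this
    exact this.eventually (ge_mem_nhds hδ)
  have hzero : ∀ w, Tendsto (fun l : ℕ => h (w / lam ^ l)) atTop (𝓝 0) := by
    intro w
    have h1 := ((tendsto_div_pow hlam w).norm).const_mul C
    rw [norm_zero, mul_zero] at h1
    exact squeeze_zero_norm' ((hsm w).mono fun l hl => (hA _ hl).1) h1
  have hasym : ∀ w, ∀ᶠ l : ℕ in atTop,
      ‖h (w / lam ^ l) - A * w / lam ^ l‖ ≤ C * ‖w‖ ^ 2 * (1 / ‖lam‖ ^ 2) ^ l := by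
    intro w
    filter_upwards [hsm w] with l hl
    have := (hA _ hl).2
    rw [← mul_div_assoc] at this
    refine this.trans (le_of_eq ?_)
    rw [norm_div, norm_pow, div_pow, div_pow, ← pow_mul, ← pow_mul, mul_comm l 2]
    ring
  have hμ0 : 0 < ‖lam‖ := by linarith
  have hη0 : 0 < 1 / ‖lam‖ ^ 2 := by positivity
  have hη : 1 / ‖lam‖ ^ 2 * ‖lam‖ < 1 := by
    rw [one_div_mul_eq_div, div_lt_one (by positivity)]
    nlinarith
  -- If `A` vanished, the backward orbit of `h w₀` would be `O(‖lam‖ ^ (-2l))`, hence equal to the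
  -- zero orbit by uniqueness.
  have hA0 : A ≠ 0 := by
    rintro rfl
    have h1 := backward_orbit_unique hp1 (hback w₀) (x' := fun _ => 0)
      (fun _ => by rw [← coeff_zero_eq_eval_zero, hp0]) (hzero w₀) tendsto_const_nhds hη0 hη
      ((hasym w₀).mono fun l hl => by simpa using hl) 0
    exact hw₀ (by simpa using h1)
  obtain ⟨ζ, C', η, hC', hη', hημ, hζ⟩ := backward_orbit_asymptotic hlam hp0 hp1 hx hx0
  refine ⟨ζ / A, backward_orbit_unique hp1 (hback _) hx (hzero _) hx0
    (C := C * ‖ζ / A‖ ^ 2 + C') (η := max (1 / ‖lam‖ ^ 2) η) (lt_max_of_lt_left hη0) ?_ ?_⟩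
  · rw [max_mul_of_nonneg _ _ hμ0.le]
    exact max_lt hη hημ
  · filter_upwards [hasym (ζ / A), hζ] with l h1 h2
    rw [mul_div_cancel₀ _ hA0] at h1
    calc _ = ‖(h (ζ / A / lam ^ l) - ζ / lam ^ l) - (x l - ζ / lam ^ l)‖ := by congr 1; ring
      _ ≤ C * ‖ζ / A‖ ^ 2 * (1 / ‖lam‖ ^ 2) ^ l + C' * η ^ l :=
        (norm_sub_le _ _).trans (add_le_add h1 h2)
      _ ≤ C * ‖ζ / A‖ ^ 2 * (max (1 / ‖lam‖ ^ 2) η) ^ l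
          + C' * (max (1 / ‖lam‖ ^ 2) η) ^ l := by
        gcongr
        · exact le_max_left _ _
        · exact le_max_right _ _
      _ = _ := by ring

end Limit

/-! ### Contraction of vertical disks during one passage. -/

section Disks

variable {lam : ℂ} {p q : ℂ[X]} {x₀ : ℂ} {k : ℕ}

theorem exists_norm_skewProduct_le (lam : ℂ) (p q : ℂ[X]) (R : ℝ) :
    ∃ M : ℝ, ∀ a : ℂ × ℂ, ‖a‖ ≤ R → ‖skewProduct lam p q a‖ ≤ M := by
  obtain ⟨M, hM⟩ := (isCompact_closedBall (0 : ℂ × ℂ) R).exists_bound_of_continuousOn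
    (contDiff_skewProduct lam p q).continuous.continuousOn
  exact ⟨M, fun a ha => hM a (mem_closedBall_zero_iff.2 ha)⟩

theorem norm_iterate_sub_of_fst_eq (lam : ℂ) (p q : ℂ[X]) (j : ℕ) (t z z' : ℂ) :
    ‖(skewProduct lam p q)^[j] (t, z) - (skewProduct lam p q)^[j] (t, z')‖ =
      ‖((skewProduct lam p q)^[j] (t, z)).2 - ((skewProduct lam p q)^[j] (t, z')).2‖ := by
  rw [Prod.norm_def, Prod.fst_sub, Prod.snd_sub, skewProduct_iterate_fst, skewProduct_iterate_fst,
    sub_self, norm_zero]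
  exact max_eq_right (norm_nonneg _)

/-- Small vertical disks around the degenerate critical point are contracted during the passage
near the saddle. -/
theorem exists_norm_iterate_sub_criticalOrbit_le (hlam : 1 < ‖lam‖) (hp0 : p.coeff 0 = 0)
    (hp1 : p.coeff 1 = lam) (hq0 : q.coeff 0 = 0)
    (hx₀ : 3 ≤ p.derivative.rootMultiplicity x₀)
    (hk : (fun z : ℂ => p.eval z)^[k] x₀ = 0)
    {ν : ℝ} (hν : ‖lam‖ < ν) (hν3 : ν < ‖lam‖ ^ 3) (w : ℂ) :
    ∃ (C : ℝ) (N : ℕ), 0 < C ∧ ∀ n, N ≤ n → ∀ z, ‖z - x₀‖ ^ 4 ≤ 1 / (‖lam‖ ^ 3) ^ n →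
      ∀ j, 1 ≤ j → j ≤ n →
        ‖((skewProduct lam p q)^[j] (w / lam ^ n, z)).2 - criticalOrbit lam p q x₀ j (w / lam ^ n)‖
          ≤ C * (ν / ‖lam‖ ^ 3) ^ n := by
  obtain ⟨C₁, δ₁, hC₁, hδ₁, hδ₁1, hA⟩ := exists_norm_criticalOrbit_le hlam hp0 hp1 hq0 hk
  obtain ⟨K, hK, hP⟩ := p.exists_norm_increment_le
  rw [hp1] at hP
  obtain ⟨K₄, hK₄, hP4⟩ := exists_norm_sub_le_pow_four hx₀
  obtain ⟨M, hM⟩ := exists_norm_skewProduct_le lam p q (2 + ‖x₀‖)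
  obtain ⟨K₁, hK₁, hLip₁⟩ := exists_lipschitz_iterate lam p q k M
  set μ := ‖lam‖ with hμ
  have hμ0 : 0 < μ := by linarith
  have hν0 : 0 < ν := by linarith
  have hν1 : 1 ≤ ν := by linarith
  set θ := ν / μ ^ 3
  have hθ0 : 0 < θ := by positivity
  have hθ1 : θ < 1 := (div_lt_one (by positivity)).2 hν3
  have hθn : ∀ n, θ ^ n = ν ^ n / (μ ^ 3) ^ n := fun n => div_pow _ _ _
  -- The critical orbit will have size at most `ε` and its neighbour at most `2 * ε`; their sum `3 *
  -- ε` keeps the expansion per step below `ν`.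
  obtain ⟨ε, hε0, hε1, hε2⟩ : ∃ ε : ℝ, 0 < ε ∧ 2 * ε ≤ 1 ∧ K * (3 * ε) ≤ ν - μ := by
    have h1 : 0 < ν - μ := by linarith
    refine ⟨min (1 / 2) ((ν - μ) / (3 * K)), by positivity, ?_, ?_⟩
    · linarith [min_le_left (1 / 2) ((ν - μ) / (3 * K))]
    · have := min_le_right (1 / 2) ((ν - μ) / (3 * K))
      rw [le_div_iff₀ (by positivity)] at this
      linarith
  set δ := min δ₁ (ε / C₁)
  have hδ0 : 0 < δ := by positivity
  set E := K₁ * K₄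
  have hE0 : 0 < E := by positivity
  obtain ⟨L, hL⟩ := pow_unbounded_of_one_lt (‖w‖ / δ) hlam
  obtain ⟨K₂, hK₂, hLip₂⟩ := exists_lipschitz_iterate lam p q L 1
  obtain ⟨N₁, hN₁⟩ : ∃ N₁ : ℕ, ∀ n, N₁ ≤ n → E * θ ^ n ≤ ε := by
    have hlim : Tendsto (fun n : ℕ => E * θ ^ n) atTop (𝓝 (E * 0)) :=
      (tendsto_pow_atTop_nhds_zero_of_lt_one hθ0.le hθ1).const_mul _
    rw [mul_zero] at hlim
    exact eventually_atTop.1 (hlim.eventually (ge_mem_nhds hε0))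
  obtain ⟨N₂, hN₂⟩ : ∃ N₂ : ℕ, ∀ n, N₂ ≤ n → ‖w / lam ^ n‖ ≤ 1 / 2 := by
    have hlim := (tendsto_div_pow hlam w).norm
    rw [norm_zero] at hlim
    exact eventually_atTop.1 (hlim.eventually (ge_mem_nhds one_half_pos))
  refine ⟨E + K₂ * E, max (max N₁ N₂) (k + 1 + L), by positivity, fun n hn z hz => ?_⟩
  have hn₁ := hN₁ n (by omega)
  have hn₂ := hN₂ n (by omega)
  set t := w / lam ^ n with ht
  have hz1 : ‖z - x₀‖ ≤ 1 := by
    have h1 : ‖z - x₀‖ ^ 4 ≤ 1 :=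
      hz.trans ((div_le_one (by positivity)).2 (one_le_pow₀ (one_le_pow₀ hlam.le)))
    exact (pow_le_one_iff_of_nonneg (norm_nonneg _) (by norm_num)).1 h1
  have hzn : ‖z‖ ≤ 2 + ‖x₀‖ := by
    calc ‖z‖ = ‖(z - x₀) + x₀‖ := by simp
      _ ≤ _ := (norm_add_le _ _).trans (by linarith)
  -- The first step gives the fourth power of the distance to `x₀`, and at most `k` Lipschitz steps
  -- follow. Time `0` is excluded because no contraction has happened yet.
  have early : ∀ j, 1 ≤ j → j ≤ k + 1 →
      ‖((skewProduct lam p q)^[j] (t, z)).2 - criticalOrbit lam p q x₀ j t‖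
        ≤ E * (1 / (μ ^ 3) ^ n) := by
    intro j hj1 hjk
    obtain ⟨i, rfl⟩ : ∃ i, j = i + 1 := ⟨j - 1, by omega⟩
    rw [criticalOrbit_eq_snd, ← norm_iterate_sub_of_fst_eq, Function.iterate_succ_apply,
      Function.iterate_succ_apply]
    have hxb : (0 : ℝ) ≤ ‖x₀‖ := norm_nonneg _
    refine (hLip₁ i (by omega) _ _ (hM _ (max_le (by simp only; linarith) hzn))
      (hM _ (max_le (by simp only; linarith) (by simp)))).trans ?_
    have h1 := norm_iterate_sub_of_fst_eq lam p q 1 t z x₀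
    simp only [Function.iterate_one] at h1
    rw [h1, mul_assoc]
    gcongr
    simp only [skewProduct, add_sub_add_right_eq_sub]
    exact (hP4 z hz1).trans (by gcongr)
  -- Near the saddle the gap grows by at most `ν` per step; its bound `E * θ ^ n ≤ ε` keeps the
  -- nearby orbit in the region where this holds.
  have middle : ∀ j, k + 1 ≤ j → j ≤ n → μ ^ j * ‖t‖ ≤ δ →
      ‖((skewProduct lam p q)^[j] (t, z)).2 - criticalOrbit lam p q x₀ j t‖
        ≤ E * (ν ^ j / (μ ^ 3) ^ n) := by
    intro j hj
    induction j, hj using Nat.le_induction with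
    | base =>
      intro _ _
      refine (early (k + 1) (by omega) le_rfl).trans ?_
      gcongr
      exact one_le_pow₀ hν1
    | succ j hj ih =>
      intro hjn1 hx
      have hjn : j ≤ n := by omega
      have hx' := (pow_mul_le_succ hlam t j).trans hx
      have hg := ih hjn hx'
      have hy := hA j t (by omega) (hx'.trans (min_le_left _ _))
      rw [skewProduct_iterate_succ_snd, criticalOrbit_succ, add_sub_add_right_eq_sub]
      set y := criticalOrbit lam p q x₀ j t
      set y' := ((skewProduct lam p q)^[j] (t, z)).2
      have hgε : ‖y' - y‖ ≤ ε := by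
        refine hg.trans (le_trans ?_ hn₁)
        rw [hθn]
        gcongr
      have hyε : ‖y‖ ≤ ε := by
        refine hy.trans ?_
        calc _ ≤ C₁ * (ε / C₁) := by gcongr; exact hx'.trans (min_le_right _ _)
          _ = ε := by field_simp
      have hyε' : ‖y'‖ ≤ 2 * ε := by
        calc ‖y'‖ = ‖(y' - y) + y‖ := by simp
          _ ≤ _ := (norm_add_le _ _).trans (by linarith)
      have hp := hP y y' (by linarith) (by linarith)
      calc ‖p.eval y' - p.eval y‖
          = ‖lam * (y' - y) + (p.eval y' - p.eval y - lam * (y' - y))‖ := by congr 1; ring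
        _ ≤ μ * ‖y' - y‖ + K * (3 * ε) * ‖y' - y‖ := by
          refine (norm_add_le _ _).trans (add_le_add ?_ (hp.trans ?_))
          · rw [norm_mul]
          · gcongr; linarith
        _ ≤ μ * ‖y' - y‖ + (ν - μ) * ‖y' - y‖ := by gcongr
        _ = ν * ‖y' - y‖ := by ring
        _ ≤ ν * (E * (ν ^ j / (μ ^ 3) ^ n)) := by gcongr
        _ = _ := by ring
  have before : ∀ j, 1 ≤ j → j + L ≤ n →
      ‖((skewProduct lam p q)^[j] (t, z)).2 - criticalOrbit lam p q x₀ j t‖ ≤ E * θ ^ n := by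
    intro j hj1 hjn
    rw [hθn]
    rcases le_or_gt j (k + 1) with hj | hj
    · refine (early j hj1 hj).trans ?_
      gcongr
      exact one_le_pow₀ hν1
    · have hx : μ ^ j * ‖t‖ ≤ δ := by
        rw [ht, norm_div, norm_pow, ← hμ]
        rw [div_lt_iff₀ hδ0] at hL
        rw [← mul_div_assoc, div_le_iff₀ (by positivity)]
        calc μ ^ j * ‖w‖ ≤ μ ^ j * (μ ^ L * δ) := by gcongr
          _ = δ * μ ^ (j + L) := by rw [pow_add]; ring
          _ ≤ _ := by
            gcongr
            exact hlam.le
      refine (middle j hj.le (by omega) hx).trans ?_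
      gcongr
      omega
  intro j hj1 hjn
  have hKE : 0 ≤ K₂ * (E * θ ^ n) := by positivity
  rcases le_or_gt (j + L) n with hj | hj
  · refine (before j hj1 hj).trans ?_
    rw [add_mul]
    nlinarith
  -- The remaining times are at most `L` steps after `i = n - L`, so a fixed Lipschitz constant
  -- suffices.
  · obtain ⟨i, rfl⟩ : ∃ i, n = i + L := ⟨n - L, by omega⟩
    obtain ⟨l, rfl⟩ : ∃ l, j = l + i := ⟨j - i, by omega⟩
    have hb := before i (by omega) le_rfl
    have hxi : μ ^ i * ‖t‖ ≤ δ := by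
      rw [ht, norm_div, norm_pow, ← hμ, pow_add]
      rw [div_lt_iff₀ hδ0] at hL
      rw [show μ ^ i * (‖w‖ / (μ ^ i * μ ^ L)) = ‖w‖ / μ ^ L by field_simp,
        div_le_iff₀ (by positivity)]
      linarith
    have hy : ‖criticalOrbit lam p q x₀ i t‖ ≤ ε := by
      refine (hA i t (by omega) (hxi.trans (min_le_left _ _))).trans ?_
      calc _ ≤ C₁ * (ε / C₁) := by gcongr; exact hxi.trans (min_le_right _ _)
        _ = ε := by field_simp
    have hy' : ‖((skewProduct lam p q)^[i] (t, z)).2‖ ≤ 1 := by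
      calc _ = ‖(((skewProduct lam p q)^[i] (t, z)).2 - criticalOrbit lam p q x₀ i t)
            + criticalOrbit lam p q x₀ i t‖ := by congr 1; ring
        _ ≤ _ := (norm_add_le _ _).trans (by linarith)
    have hti := norm_div_pow_le hlam t i
    rw [criticalOrbit_eq_snd, ← norm_iterate_sub_of_fst_eq, Function.iterate_add_apply,
      Function.iterate_add_apply]
    refine (hLip₂ l (by omega) _ _ (max_le ?_ hy') ?_).trans ?_
    · rw [skewProduct_iterate_fst]
      linarith
    · rw [skewProduct_iterate_critical lam p q x₀ i t]
      exact max_le (by simp only; linarith) (by simp only; linarith)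
    · rw [norm_iterate_sub_of_fst_eq, ← criticalOrbit_eq_snd lam p q x₀, add_mul, mul_assoc K₂]
      have h1 : 0 ≤ E * θ ^ (i + L) := by positivity
      have h2 := mul_le_mul_of_nonneg_left hb hK₂.le
      linarith

end Disks

/-! ### Closedness and invariance of Ω. -/

section OrbitSet

variable {p : ℂ[X]} {x₀ : ℂ} {k : ℕ} {x : ℤ → ℂ}

theorem mem_orbitSet_iff {z : ℂ} : z ∈ orbitSet k x ↔ ∃ m : ℤ, m ≤ k ∧ z = x m := by
  constructor
  · rintro ⟨l, hl, rfl⟩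
    exact ⟨-l, by omega, rfl⟩
  · rintro ⟨m, hm, rfl⟩
    exact ⟨-m, by omega, by rw [neg_neg]⟩

theorem IsBackwardOrbit.apply_natCast (hx : IsBackwardOrbit p x₀ k x) {j : ℕ} (hj : j ≤ k) :
    x j = (fun z : ℂ => p.eval z)^[j] x₀ := by
  induction j with
  | zero => exact hx.1
  | succ j ih =>
    rw [Function.iterate_succ_apply', ← ih (by omega), hx.2.1 j (by omega)]
    push_cast
    rfl

/-- Ω is a convergent sequence together with its limit: the limit `0` already belongs to it as `x
k`. -/
theorem IsBackwardOrbit.isClosed_orbitSet (hx : IsBackwardOrbit p x₀ k x)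
    (hk : (fun z : ℂ => p.eval z)^[k] x₀ = 0) : IsClosed (orbitSet k x) := by
  have hxk : x k = 0 := (hx.apply_natCast le_rfl).trans hk
  have hlim : Tendsto (fun l : ℕ => x (k - l)) atTop (𝓝 0) := by
    rw [← tendsto_add_atTop_iff_nat k]
    refine hx.2.2.congr fun l => ?_
    congr 1
    push_cast
    ring
  have : orbitSet k x = insert 0 (Set.range fun l : ℕ => x (k - l)) := by
    ext z
    rw [mem_orbitSet_iff, Set.mem_insert_iff, Set.mem_range]
    constructor
    · rintro ⟨m, hm, rfl⟩
      refine Or.inr ⟨(k - m).toNat, ?_⟩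
      congr 1
      omega
    · rintro (rfl | ⟨l, rfl⟩)
      · exact ⟨k, le_rfl, hxk.symm⟩
      · exact ⟨k - l, by omega, rfl⟩
  rw [this]
  exact hlim.isCompact_insert_range.isClosed

/-- Applying `p` shifts the index; the top entry `x k = 0` is fixed, and each entry has its
predecessor as a preimage. -/
theorem IsBackwardOrbit.image_orbitSet (hx : IsBackwardOrbit p x₀ k x) (hp0 : p.eval 0 = 0)
    (hk : (fun z : ℂ => p.eval z)^[k] x₀ = 0) :
    (fun z : ℂ => p.eval z) '' orbitSet k x = orbitSet k x := by
  have hxk : x k = 0 := (hx.apply_natCast le_rfl).trans hk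
  ext z
  simp only [Set.mem_image, mem_orbitSet_iff]
  constructor
  · rintro ⟨_, ⟨m, hm, rfl⟩, rfl⟩
    rcases hm.lt_or_eq with hm | rfl
    · exact ⟨m + 1, by omega, hx.2.1 m hm⟩
    · exact ⟨k, le_rfl, by rw [hxk, hp0]⟩
  · rintro ⟨m, hm, rfl⟩
    exact ⟨x (m - 1), ⟨m - 1, by omega, rfl⟩, by rw [hx.2.1 _ (by omega), sub_add_cancel]⟩

end OrbitSet

/-! ### Shadowing and ω-limit sets through passages of doubling length. -/

section OmegaLimit

variable {lam : ℂ} {p q : ℂ[X]} {x₀ : ℂ} {k : ℕ} {x : ℤ → ℂ} {w : ℂ}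

theorem continuous_criticalOrbit (lam : ℂ) (p q : ℂ[X]) (x₀ : ℂ) (j : ℕ) :
    Continuous (criticalOrbit lam p q x₀ j) :=
  (orbitPoly lam p q x₀ 0 j).continuous

/-- Critical orbits starting in the fibre over `w / lam ^ n` follow `x` up to time `n`. -/
theorem eventually_criticalOrbit_near (hlam : 1 < ‖lam‖) (hp0 : p.coeff 0 = 0)
    (hp1 : p.coeff 1 = lam) (hq0 : q.coeff 0 = 0)
    (hk : (fun z : ℂ => p.eval z)^[k] x₀ = 0) (hx : IsBackwardOrbit p x₀ k x)
    (hlim : ∀ l : ℕ, Tendsto (fun n => criticalOrbit lam p q x₀ (n - l) (w / lam ^ n)) atTop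
      (𝓝 (x (-l)))) {ε : ℝ} (hε : 0 < ε) :
    ∀ᶠ n : ℕ in atTop, ∀ j ≤ n, ∃ m : ℤ, m ≤ k ∧
      ‖criticalOrbit lam p q x₀ j (w / lam ^ n) - x m‖ ≤ ε := by
  obtain ⟨C, δ, hC, hδ, hδ1, hA⟩ := exists_norm_criticalOrbit_le hlam hp0 hp1 hq0 hk
  have hxk : x k = 0 := (hx.apply_natCast le_rfl).trans hk
  set μ := ‖lam‖ with hμ
  have hμ0 : 0 < μ := by linarith
  set δ' := min δ (ε / C)
  have hδ' : 0 < δ' := by positivity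
  obtain ⟨L, hL⟩ := pow_unbounded_of_one_lt (‖w‖ / δ') hlam
  have near : ∀ {u : ℕ → ℂ} {a : ℂ}, Tendsto u atTop (𝓝 a) → ∀ᶠ n in atTop, ‖u n - a‖ ≤ ε := by
    intro u a h
    have := (tendsto_iff_norm_sub_tendsto_zero.1 h)
    exact this.eventually (ge_mem_nhds hε)
  have early : ∀ᶠ n : ℕ in atTop, ∀ j ∈ Finset.range k,
      ‖criticalOrbit lam p q x₀ j (w / lam ^ n) - x j‖ ≤ ε := by
    rw [Finset.eventually_all]
    intro j hj
    rw [Finset.mem_range] at hj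
    refine near ?_
    have := ((continuous_criticalOrbit lam p q x₀ j).tendsto 0).comp (tendsto_div_pow hlam w)
    rwa [criticalOrbit_zero_right hq0, ← hx.apply_natCast hj.le] at this
  have late : ∀ᶠ n : ℕ in atTop, ∀ l ∈ Finset.range L,
      ‖criticalOrbit lam p q x₀ (n - l) (w / lam ^ n) - x (-l)‖ ≤ ε := by
    rw [Finset.eventually_all]
    exact fun l _ => near (hlim l)
  -- Times `j < k` follow the forward orbit of `x₀`, times `j > n - L` follow the backward tail, and
  -- all others stay close to `0 = x k`.
  filter_upwards [early, late] with n h1 h2 j hjn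
  rcases lt_or_ge j k with hj | hj
  · exact ⟨j, by omega, h1 j (Finset.mem_range.2 hj)⟩
  rcases lt_or_ge n (j + L) with hj' | hj'
  · have := h2 (n - j) (Finset.mem_range.2 (by omega))
    rw [Nat.sub_sub_self hjn] at this
    exact ⟨_, by omega, this⟩
  · refine ⟨k, le_rfl, ?_⟩
    have hxj : μ ^ j * ‖w / lam ^ n‖ ≤ δ' := by
      rw [norm_div, norm_pow, ← hμ]
      rw [div_lt_iff₀ hδ'] at hL
      rw [← mul_div_assoc, div_le_iff₀ (by positivity)]
      calc μ ^ j * ‖w‖ ≤ μ ^ j * (μ ^ L * δ') := by gcongr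
        _ = δ' * μ ^ (j + L) := by rw [pow_add]; ring
        _ ≤ _ := by
          gcongr
          exact hlam.le
    rw [hxk, sub_zero]
    refine (hA j _ hj (hxj.trans (min_le_left _ _))).trans ?_
    calc _ ≤ C * (ε / C) := by gcongr; exact hxj.trans (min_le_right _ _)
      _ = ε := by field_simp

/-- The set of times covered by the successive passages of lengths `n, 2n, 4n, …`. -/
theorem exists_passage {n : ℕ} (hn : 1 ≤ n) (s₀ : ℕ) {i : ℕ} (hi : (2 ^ s₀ - 1) * n ≤ i) :
    ∃ s j, s₀ ≤ s ∧ j ≤ 2 ^ s * n ∧ i = j + (2 ^ s - 1) * n := by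
  induction i, hi using Nat.le_induction with
  | base => exact ⟨s₀, 0, le_rfl, Nat.zero_le _, by omega⟩
  | succ i _ ih =>
    obtain ⟨s, j, hs, hj, rfl⟩ := ih
    rcases hj.lt_or_eq with hj | rfl
    · exact ⟨s, j + 1, hs, hj, by ring⟩
    -- The end of passage `s` is time `0` of passage `s + 1`, so the next time is its time `1`.
    · refine ⟨s + 1, 1, by omega, ?_, ?_⟩
      · exact Nat.mul_pos (by positivity) hn
      · have h1 : 1 ≤ 2 ^ s := Nat.one_le_two_pow
        zify [h1, Nat.one_le_two_pow (n := s + 1)]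
        ring

/-- Passages of lengths `n, 2n, …, 2 ^ (s - 1) * n` take total time `(2 ^ s - 1) * n`. -/
theorem iterate_mem_of_forall_doubling {X : Type*} {F : X → X} {D : ℕ → Set X} {N n : ℕ}
    (hD : ∀ m, N ≤ m → ∀ y ∈ D m, F^[m] y ∈ D (2 * m)) (hn : N ≤ n) (s : ℕ) {y : X}
    (hy : y ∈ D n) : F^[(2 ^ s - 1) * n] y ∈ D (2 ^ s * n) := by
  induction s with
  | zero => simpa using hy
  | succ s ih =>
    have h1 : 1 ≤ 2 ^ s := Nat.one_le_two_pow
    have e : (2 ^ (s + 1) - 1) * n = 2 ^ s * n + (2 ^ s - 1) * n := by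
      zify [h1, Nat.one_le_two_pow (n := s + 1)]
      ring
    rw [e, Function.iterate_add_apply, pow_succ, mul_comm (2 ^ s) 2, mul_assoc]
    exact hD _ (hn.trans (Nat.le_mul_of_pos_left _ (by positivity))) _ ih

/-- The `ω`-limit set of a set which passes successively through shadowing neighbourhoods `D n`,
`D (2n)`, `D (4n)`, … -/
theorem omegaSet_eq_of_passages {F : ℂ × ℂ → ℂ × ℂ} {D : ℕ → Set (ℂ × ℂ)} {S : Set (ℂ × ℂ)}
    (hS : IsClosed S) {N n : ℕ} (hD : ∀ m, N ≤ m → ∀ y ∈ D m, F^[m] y ∈ D (2 * m))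
    (hn : N ≤ n) (hn1 : 1 ≤ n) (hne : (D n).Nonempty)
    (hnear : ∀ ε : ℝ, 0 < ε → ∀ᶠ m : ℕ in atTop, ∀ y ∈ D m, ∀ j ≤ m, ∃ s ∈ S,
      ‖F^[j] y - s‖ ≤ ε)
    (hacc : ∀ s ∈ S, ∀ ε : ℝ, 0 < ε → ∀ᶠ m : ℕ in atTop, ∃ j, ∀ y ∈ D m,
      ‖F^[j] y - s‖ ≤ ε) :
    omegaSet F (D n) = S := by
  have hgrow : Tendsto (fun s : ℕ => 2 ^ s * n) atTop atTop :=
    (tendsto_pow_atTop_atTop_of_one_lt one_lt_two).atTop_mul_const' (by omega)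
  apply Set.Subset.antisymm
  · intro y hy
    rw [← hS.closure_eq, Metric.mem_closure_iff]
    intro ε hε
    obtain ⟨s₀, hs₀⟩ := eventually_atTop.1
      (hgrow.eventually (hnear (ε / 3) (by positivity)))
    unfold omegaSet at hy
    rw [mem_omegaLimit_iff_frequently] at hy
    obtain ⟨i, hi, a, ha, hia⟩ := (frequently_atTop.1
      (hy _ (Metric.ball_mem_nhds y (show 0 < ε / 3 by positivity)))) ((2 ^ s₀ - 1) * n)
    obtain ⟨s, j, hs, hj, rfl⟩ := exists_passage hn1 s₀ hi
    obtain ⟨b, hb, hbd⟩ := hs₀ s hs _ (iterate_mem_of_forall_doubling hD hn s ha) j hj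
    rw [← Function.iterate_add_apply, ← dist_eq_norm] at hbd
    rw [Set.mem_preimage, Metric.mem_ball] at hia
    refine ⟨b, hb, ?_⟩
    calc dist y b ≤ dist y (F^[j + (2 ^ s - 1) * n] a) + dist (F^[j + (2 ^ s - 1) * n] a) b :=
          dist_triangle _ _ _
      _ < ε := by rw [dist_comm y]; linarith
  · intro b hb
    unfold omegaSet
    rw [mem_omegaLimit_iff_frequently]
    intro U hU
    obtain ⟨ε, hε, hεU⟩ := Metric.mem_nhds_iff.1 hU
    obtain ⟨a, ha⟩ := hne
    rw [frequently_atTop]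
    intro T
    -- Requiring `2 ^ s * n ≥ T + n` makes the passage start at time `(2 ^ s - 1) * n ≥ T`.
    obtain ⟨s, hs, hsT⟩ := ((hgrow.eventually (hacc b hb (ε / 2) (by positivity))).and
      (hgrow.eventually (eventually_ge_atTop (T + n)))).exists
    obtain ⟨j, hj⟩ := hs
    refine ⟨j + (2 ^ s - 1) * n, ?_, a, ha, hεU ?_⟩
    · rw [Nat.sub_mul]; omega
    · change dist (F^[j + (2 ^ s - 1) * n] a) b < ε
      rw [dist_eq_norm, Function.iterate_add_apply]
      exact (hj _ (iterate_mem_of_forall_doubling hD hn s ha)).trans_lt (by linarith)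

end OmegaLimit

/-! ### The disks in critical fibres and their ω-limit sets. -/

section CriticalDisks

variable {lam : ℂ} {p q : ℂ[X]} {x₀ : ℂ} {k : ℕ} {x : ℤ → ℂ} {w : ℂ} {h : ℂ → ℂ}

theorem criticalDisk_radius_pow_four (lam : ℂ) (n : ℕ) :
    (‖lam‖ ^ (-(3 * (n : ℝ) / 4))) ^ 4 = 1 / (‖lam‖ ^ 3) ^ n := by
  have h0 : 0 ≤ ‖lam‖ := norm_nonneg _
  rw [← Real.rpow_natCast (‖lam‖ ^ _), ← Real.rpow_mul h0, ← pow_mul, one_div,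
    ← Real.rpow_natCast, ← Real.rpow_neg h0]
  congr 1
  push_cast
  ring

/-- The squared radius at `2 * n` equals the fourth power of the radius at `n`; comparing powers
avoids fractional exponents. -/
theorem criticalDisk_radius_two_mul_sq (lam : ℂ) (n : ℕ) :
    (‖lam‖ ^ (-(3 * ((2 * n : ℕ) : ℝ) / 4))) ^ 2 = 1 / (‖lam‖ ^ 3) ^ n := by
  have h0 : 0 ≤ ‖lam‖ := norm_nonneg _
  rw [← Real.rpow_natCast (‖lam‖ ^ _), ← Real.rpow_mul h0, ← pow_mul, one_div,
    ← Real.rpow_natCast, ← Real.rpow_neg h0]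
  congr 1
  push_cast
  ring

theorem mem_criticalDisk {n : ℕ} {y : ℂ × ℂ} : y ∈ criticalDisk lam x₀ w n ↔
    y.1 = w / lam ^ n ∧ ‖y.2 - x₀‖ < ‖lam‖ ^ (-(3 * (n : ℝ) / 4)) := by
  rw [criticalDisk, verticalDisk, Set.mem_prod, Set.mem_singleton_iff, Metric.mem_ball,
    dist_eq_norm]

theorem norm_pow_four_le_of_mem_criticalDisk {n : ℕ} {y : ℂ × ℂ}
    (hy : y ∈ criticalDisk lam x₀ w n) : ‖y.2 - x₀‖ ^ 4 ≤ 1 / (‖lam‖ ^ 3) ^ n := by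
  rw [← criticalDisk_radius_pow_four lam]
  have := (mem_criticalDisk.1 hy).2.le
  gcongr

theorem tendsto_criticalDisk_radius (hlam : 1 < ‖lam‖) :
    Tendsto (fun n : ℕ => ‖lam‖ ^ (-(3 * (n : ℝ) / 4))) atTop (𝓝 0) := by
  have h0 : 0 < ‖lam‖ := by linarith
  have h1 : ‖lam‖ ^ (-(3 / 4) : ℝ) < 1 := Real.rpow_lt_one_of_one_lt_of_neg hlam (by norm_num)
  refine (tendsto_pow_atTop_nhds_zero_of_lt_one (by positivity) h1).congr fun n => ?_
  rw [← Real.rpow_natCast, ← Real.rpow_mul h0.le]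
  congr 1
  ring

/-- Points of the disks in the critical fibres follow the critical orbits. -/
theorem eventually_criticalDisk_shadow (hlam : 1 < ‖lam‖) (hp0 : p.coeff 0 = 0)
    (hp1 : p.coeff 1 = lam) (hq0 : q.coeff 0 = 0)
    (hx₀ : 3 ≤ p.derivative.rootMultiplicity x₀)
    (hk : (fun z : ℂ => p.eval z)^[k] x₀ = 0) (w : ℂ) {ε : ℝ} (hε : 0 < ε) :
    ∀ᶠ n : ℕ in atTop, ∀ y ∈ criticalDisk lam x₀ w n, ∀ j ≤ n,
      ‖(skewProduct lam p q)^[j] y - (0, criticalOrbit lam p q x₀ j (w / lam ^ n))‖ ≤ ε := by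
  have hμ0 : 0 < ‖lam‖ := by linarith
  obtain ⟨ν, hν, hν3⟩ := exists_between (show ‖lam‖ < ‖lam‖ ^ 3 from
    lt_self_pow₀ hlam (by norm_num))
  have hν0 : 0 < ν := by linarith
  obtain ⟨C, N, hC, hN⟩ :=
    exists_norm_iterate_sub_criticalOrbit_le hlam hp0 hp1 hq0 hx₀ hk hν hν3 w
  have h1 : Tendsto (fun n : ℕ => C * (ν / ‖lam‖ ^ 3) ^ n) atTop (𝓝 (C * 0)) :=
    (tendsto_pow_atTop_nhds_zero_of_lt_one (by positivity)
      ((div_lt_one (by positivity)).2 hν3)).const_mul _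
  rw [mul_zero] at h1
  have h2 := (tendsto_div_pow hlam w).norm
  rw [norm_zero] at h2
  filter_upwards [eventually_ge_atTop N, h1.eventually (ge_mem_nhds hε),
    h2.eventually (ge_mem_nhds hε),
    (tendsto_criticalDisk_radius hlam).eventually (ge_mem_nhds hε)] with n hn e1 e2 e3 y hy j hj
  obtain ⟨hy1, hy2⟩ := mem_criticalDisk.1 hy
  refine max_le ?_ ?_
  · rw [Prod.fst_sub, skewProduct_iterate_fst, hy1, sub_zero]
    exact (norm_div_pow_le hlam _ _).trans e2
  · rcases Nat.eq_zero_or_pos j with rfl | hj0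
    · simpa [criticalOrbit, orbitPoly] using hy2.le.trans e3
    · have := hN n hn y.2 (norm_pow_four_le_of_mem_criticalDisk hy) j hj0 hj
      rw [← hy1] at this ⊢
      exact this.trans e1

/-- In the degenerate resonant case the disks in the critical fibres are mapped into each other. -/
theorem exists_criticalDisk_mapsTo (hlam : 1 < ‖lam‖) (hp0 : p.coeff 0 = 0)
    (hp1 : p.coeff 1 = lam) (hq0 : q.coeff 0 = 0)
    (hx₀ : 3 ≤ p.derivative.rootMultiplicity x₀)
    (hk : (fun z : ℂ => p.eval z)^[k] x₀ = 0) {ν : ℝ} (hν : ‖lam‖ < ν) (hν3 : ν ^ 2 < ‖lam‖ ^ 3)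
    {C' : ℝ} {N' : ℕ} (hw : ∀ n, N' ≤ n →
      ‖criticalOrbit lam p q x₀ n (w / lam ^ n) - x₀‖ ≤ C' * (ν / ‖lam‖ ^ 3) ^ n) :
    ∃ N : ℕ, ∀ n, N ≤ n → ∀ y ∈ criticalDisk lam x₀ w n,
      (skewProduct lam p q)^[n] y ∈ criticalDisk lam x₀ w (2 * n) := by
  have hμ0 : 0 < ‖lam‖ := by linarith
  have hν0 : 0 < ν := by linarith
  have hν1 : ν < ‖lam‖ ^ 3 := by nlinarith
  obtain ⟨C, N, hC, hN⟩ :=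
    exists_norm_iterate_sub_criticalOrbit_le hlam hp0 hp1 hq0 hx₀ hk hν hν1 w
  -- After squaring, the bound `(C + C') * (ν / ‖lam‖ ^ 3) ^ n` is below the radius at `2 * n`
  -- exactly when this quantity is less than `1`.
  have hlim : Tendsto (fun n : ℕ => (C + C') ^ 2 * (ν ^ 2 / ‖lam‖ ^ 3) ^ n) atTop
      (𝓝 ((C + C') ^ 2 * 0)) :=
    (tendsto_pow_atTop_nhds_zero_of_lt_one (by positivity)
      ((div_lt_one (by positivity)).2 hν3)).const_mul _
  rw [mul_zero] at hlim
  obtain ⟨M, hM⟩ := eventually_atTop.1 (hlim.eventually (gt_mem_nhds one_pos))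
  refine ⟨max (max N N') (max M 1), fun n hn y hy => ?_⟩
  obtain ⟨hy1, hy2⟩ := mem_criticalDisk.1 hy
  rw [mem_criticalDisk]
  constructor
  · rw [skewProduct_iterate_fst, hy1, div_div, ← pow_add, two_mul]
  · have h1 := hN n (by omega) y.2 (norm_pow_four_le_of_mem_criticalDisk hy) n (by omega)
      le_rfl
    rw [← hy1] at h1
    have h2 := hw n (by omega)
    rw [← hy1] at h2
    have h3 : ‖((skewProduct lam p q)^[n] y).2 - x₀‖ ≤ (C + C') * (ν / ‖lam‖ ^ 3) ^ n := by
      calc _ = ‖(((skewProduct lam p q)^[n] y).2 - criticalOrbit lam p q x₀ n y.1)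
            + (criticalOrbit lam p q x₀ n y.1 - x₀)‖ := by congr 1; ring
        _ ≤ _ := (norm_add_le _ _).trans ((add_le_add h1 h2).trans (le_of_eq (by ring)))
    refine h3.trans_lt (lt_of_pow_lt_pow_left₀ 2 (by positivity) ?_)
    rw [criticalDisk_radius_two_mul_sq lam, lt_div_iff₀ (by positivity)]
    refine lt_of_eq_of_lt ?_ (hM n (by omega))
    rw [mul_pow, mul_assoc, ← pow_mul, mul_comm n 2, pow_mul, ← mul_pow]
    congr 2
    field_simp

/-- The `ω`-limit set of a disk in a critical fibre, in terms of the limit `h` of the functions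
`w ↦ π₂ F^n(w / lam ^ n, x₀)`. -/
theorem exists_omegaSet_criticalDisk_eq (hlam : 1 < ‖lam‖) (hp0 : p.coeff 0 = 0)
    (hp1 : p.coeff 1 = lam) (hq0 : q.coeff 0 = 0)
    (hx₀ : 3 ≤ p.derivative.rootMultiplicity x₀)
    (hk : (fun z : ℂ => p.eval z)^[k] x₀ = 0) {ν : ℝ} (hν : ‖lam‖ < ν) (hν3 : ν ^ 2 < ‖lam‖ ^ 3)
    (hh : ∀ w, ∃ (C : ℝ) (N : ℕ), 0 < C ∧ ∀ n, N ≤ n →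
      ‖criticalOrbit lam p q x₀ n (w / lam ^ n) - h w‖ ≤ C * (ν / ‖lam‖ ^ 3) ^ n)
    (hx : IsBackwardOrbit p x₀ k x) (hxw : ∀ l : ℕ, h (w / lam ^ l) = x (-l)) :
    ∃ N : ℕ, ∀ n, N ≤ n →
      omegaSet (skewProduct lam p q) (criticalDisk lam x₀ w n) = {0} ×ˢ orbitSet k x := by
  have hμ0 : 0 < ‖lam‖ := by linarith
  have hν0 : 0 < ν := by linarith
  have hν1 : ν < ‖lam‖ ^ 3 := by nlinarith
  have hlimh : ∀ w, Tendsto (fun n => criticalOrbit lam p q x₀ n (w / lam ^ n)) atTop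
      (𝓝 (h w)) := by
    intro w
    obtain ⟨C, N, -, hN⟩ := hh w
    exact tendsto_of_norm_sub_le_geometric (by positivity)
      ((div_lt_one (by positivity)).2 hν1) hN
  have hlim : ∀ l : ℕ, Tendsto (fun n => criticalOrbit lam p q x₀ (n - l) (w / lam ^ n)) atTop
      (𝓝 (x (-l))) := by
    intro l
    -- Stopping `l` steps early amounts to a full passage with parameter `w / lam ^ l`.
    rw [← tendsto_add_atTop_iff_nat l, ← hxw]
    refine (hlimh _).congr fun n => ?_
    rw [Nat.add_sub_cancel, div_div, ← pow_add, add_comm]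
  obtain ⟨C', N', -, hw⟩ := hh w
  have hw0 : h w = x₀ := by simpa [hx.1] using hxw 0
  rw [hw0] at hw
  obtain ⟨N, hN⟩ := exists_criticalDisk_mapsTo hlam hp0 hp1 hq0 hx₀ hk hν hν3 hw
  refine ⟨max N 1, fun n hn => omegaSet_eq_of_passages
    (isClosed_singleton.prod (hx.isClosed_orbitSet hk)) hN (by omega) (by omega) ?_ ?_ ?_⟩
  · exact ⟨(w / lam ^ n, x₀), mem_criticalDisk.2 ⟨rfl, by simpa using by positivity⟩⟩
  · intro ε hε
    filter_upwards [eventually_criticalDisk_shadow (q := q) hlam hp0 hp1 hq0 hx₀ hk w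
      (half_pos hε), eventually_criticalOrbit_near hlam hp0 hp1 hq0 hk hx hlim (half_pos hε)]
      with n h1 h2 y hy j hj
    obtain ⟨m, hm, h3⟩ := h2 j hj
    refine ⟨(0, x m), ⟨rfl, mem_orbitSet_iff.2 ⟨m, hm, rfl⟩⟩, ?_⟩
    have h4 : ‖((0, criticalOrbit lam p q x₀ j (w / lam ^ n)) : ℂ × ℂ) - (0, x m)‖ ≤ ε / 2 := by
      simpa using h3
    linarith [norm_sub_le_norm_sub_add_norm_sub ((skewProduct lam p q)^[j] y)
      (0, criticalOrbit lam p q x₀ j (w / lam ^ n)) (0, x m), h1 y hy j hj]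
  · rintro ⟨a, b⟩ ⟨ha, hb⟩ ε hε
    obtain rfl : a = 0 := ha
    obtain ⟨m, hm, rfl⟩ := mem_orbitSet_iff.1 hb
    -- The point `x m` is approached at the fixed time `m` if `m ≥ 0`, and `|m|` steps before the
    -- end of the passage if `m < 0`.
    obtain ⟨J, hJ, hJlim⟩ : ∃ J : ℕ → ℕ, (∀ᶠ n in atTop, J n ≤ n) ∧
        Tendsto (fun n => criticalOrbit lam p q x₀ (J n) (w / lam ^ n)) atTop (𝓝 (x m)) := by
      rcases le_or_gt 0 m with hm0 | hm0
      · obtain ⟨j, rfl⟩ := Int.eq_ofNat_of_zero_le hm0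
        refine ⟨fun _ => j, eventually_ge_atTop j, ?_⟩
        have := ((continuous_criticalOrbit lam p q x₀ j).tendsto 0).comp (tendsto_div_pow hlam w)
        rwa [criticalOrbit_zero_right hq0, ← hx.apply_natCast (by omega)] at this
      · refine ⟨fun n => n - m.natAbs, Eventually.of_forall fun n => Nat.sub_le _ _, ?_⟩
        have := hlim m.natAbs
        rwa [show -(m.natAbs : ℤ) = m by omega] at this
    filter_upwards [hJ, (tendsto_iff_norm_sub_tendsto_zero.1 hJlim).eventually
      (ge_mem_nhds (half_pos hε)), eventually_criticalDisk_shadow (q := q) hlam hp0 hp1 hq0 hx₀ hk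
      w (half_pos hε)] with n h1 h2 h3
    refine ⟨J n, fun y hy => ?_⟩
    have h4 : ‖((0, criticalOrbit lam p q x₀ (J n) (w / lam ^ n)) : ℂ × ℂ) - (0, x m)‖
        ≤ ε / 2 := by
      simpa using h2
    linarith [norm_sub_le_norm_sub_add_norm_sub ((skewProduct lam p q)^[J n] y)
      (0, criticalOrbit lam p q x₀ (J n) (w / lam ^ n)) (0, x m), h3 y hy (J n) h1]

/-- The backward orbit `h (w / lam ^ l)` through `h w = x₀`, continued by the forward orbit. -/
theorem exists_isBackwardOrbit (hlam : 1 < ‖lam‖) (hp0 : p.coeff 0 = 0)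
    (hp1 : p.coeff 1 = lam) (hq0 : q.coeff 0 = 0)
    (hk : (fun z : ℂ => p.eval z)^[k] x₀ = 0)
    (hh : ∀ w, Tendsto (fun n => criticalOrbit lam p q x₀ n (w / lam ^ n)) atTop (𝓝 (h w)))
    (hw : h w = x₀) :
    ∃ x : ℤ → ℂ, IsBackwardOrbit p x₀ k x ∧ ∀ l : ℕ, h (w / lam ^ l) = x (-l) := by
  have hl0 : lam ≠ 0 := norm_pos_iff.1 (by linarith)
  obtain ⟨A, C, δ, hC, hδ, hA⟩ := rescaled_limit_near_zero hlam hp0 hp1 hq0 hk hh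
  have hback : ∀ l : ℕ, p.eval (h (w / lam ^ (l + 1))) = h (w / lam ^ l) := by
    intro l
    rw [← rescaled_limit_mul hlam hq0 hh, pow_succ', ← mul_div_assoc, mul_div_mul_left _ _ hl0]
  set x : ℤ → ℂ := fun m =>
    if 0 ≤ m then (fun z : ℂ => p.eval z)^[m.toNat] x₀ else h (w / lam ^ (-m).toNat)
  have hxw : ∀ l : ℕ, h (w / lam ^ l) = x (-l) := by
    intro l
    rcases Nat.eq_zero_or_pos l with rfl | hl
    · simp [x, hw]
    · simp only [x]
      rw [if_neg (by omega), neg_neg, Int.toNat_natCast]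
  refine ⟨x, ⟨by simp [x], fun m _ => ?_, ?_⟩, hxw⟩
  · rcases le_or_gt 0 m with hm | hm
    · simp only [x]
      rw [if_pos hm, if_pos (by omega), show (m + 1).toNat = m.toNat + 1 by omega,
        Function.iterate_succ_apply']
    · obtain ⟨l, rfl⟩ : ∃ l : ℕ, m = -((l + 1 : ℕ) : ℤ) := ⟨(-m).toNat - 1, by omega⟩
      rw [← hxw, hback, hxw]
      congr 1
      omega
  · have h1 := ((tendsto_div_pow hlam w).norm).const_mul C
    have h2 := (tendsto_div_pow hlam w).norm
    rw [norm_zero] at h1 h2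
    rw [mul_zero] at h1
    refine squeeze_zero_norm' ?_ h1
    filter_upwards [h2.eventually (ge_mem_nhds hδ)] with l hl
    rw [← hxw]
    exact (hA _ hl).1

end CriticalDisks

/-! ### The ω-limit sets of vertical disks. -/

theorem lemma5p5 (lam : ℂ) (hlam : 1 < ‖lam‖) (p q : ℂ[X])
    (hp0 : p.eval 0 = 0) (hp1 : p.derivative.eval 0 = lam)
    (hq0 : q.eval 0 = 0) (hq1 : q.derivative.eval 0 ≠ 0)
    (x₀ : ℂ) (hx₀ : 3 ≤ p.derivative.rootMultiplicity x₀)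
    (k : ℕ) (hk : (fun z : ℂ => p.eval z)^[k] x₀ = 0)
    (hF : IsDegenerateResonant lam p q x₀ k)
    (w₀ : ℂ)
    (hw₀ : Tendsto (fun n : ℕ => ((skewProduct lam p q)^[n] (w₀ / lam ^ n, x₀)).2)
      atTop (𝓝 x₀)) :
    (∃ N : ℕ, ∀ n : ℕ, N ≤ n → ∃ x : ℤ → ℂ,
      IsBackwardOrbit p x₀ k x ∧
      IsClosed (orbitSet k x) ∧
      (fun z : ℂ => p.eval z) '' orbitSet k x = orbitSet k x ∧
      omegaSet (skewProduct lam p q) (criticalDisk lam x₀ w₀ n) = {0} ×ˢ orbitSet k x) ∧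
    (∀ x : ℤ → ℂ, IsBackwardOrbit p x₀ k x →
      ∃ (t c : ℂ) (r : ℝ), 0 < r ∧
        omegaSet (skewProduct lam p q) (verticalDisk t c r) = {0} ×ˢ orbitSet k x) := by
  have hμ0 : 0 < ‖lam‖ := by linarith
  have cp0 : p.coeff 0 = 0 := by rw [coeff_zero_eq_eval_zero, hp0]
  have cq0 : q.coeff 0 = 0 := by rw [coeff_zero_eq_eval_zero, hq0]
  have cp1 : p.coeff 1 = lam := by
    rw [← hp1, ← coeff_zero_eq_eval_zero, coeff_derivative]
    simp
  -- The origin is not critical, since `p'(0) = lam ≠ 0`. The converse needs this to have a point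
  -- where `h` does not vanish.
  have hx₀0 : x₀ ≠ 0 := by
    rintro rfl
    have hroot : p.derivative.IsRoot 0 :=
      (rootMultiplicity_pos'.1 (by omega : 0 < p.derivative.rootMultiplicity 0)).2
    rw [IsRoot.def, hp1] at hroot
    simp [hroot] at hμ0
  -- The window `‖lam‖ < ν < ‖lam‖ ^ (3/2)` serves both the convergence of the passages and the
  -- inclusion of each disk's image in the next disk.
  obtain ⟨ν, hν, hν3⟩ := exists_between (show ‖lam‖ < √(‖lam‖ ^ 3) from by
    rw [Real.lt_sqrt hμ0.le]; exact pow_lt_pow_right₀ hlam (by norm_num))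
  have hν0 : 0 < ν := by linarith
  rw [Real.lt_sqrt hν0.le] at hν3
  have hν1 : ν < ‖lam‖ ^ 3 := by nlinarith
  obtain ⟨h, hh⟩ := exists_rescaled_limit hlam cp0 cp1 cq0 hk hF hν hν1
  have hlim : ∀ w, Tendsto (fun n => criticalOrbit lam p q x₀ n (w / lam ^ n)) atTop
      (𝓝 (h w)) := by
    intro w
    obtain ⟨C, N, -, hN⟩ := hh w
    exact tendsto_of_norm_sub_le_geometric (by positivity)
      ((div_lt_one (by positivity)).2 hν1) hN
  have hhw₀ : h w₀ = x₀ := by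
    refine tendsto_nhds_unique (hlim w₀) ?_
    simpa only [criticalOrbit_eq_snd] using hw₀
  constructor
  · obtain ⟨x, hx, hxw⟩ := exists_isBackwardOrbit hlam cp0 cp1 cq0 hk hlim hhw₀
    obtain ⟨N, hN⟩ :=
      exists_omegaSet_criticalDisk_eq hlam cp0 cp1 cq0 hx₀ hk hν hν3 hh hx hxw
    exact ⟨N, fun n hn => ⟨x, hx, hx.isClosed_orbitSet hk, hx.image_orbitSet hp0 hk, hN n hn⟩⟩
  · intro x hx
    -- At index `0` this gives `h w = x 0 = x₀`, so the disks with `w` in place of `w₀` also return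
    -- to `x₀`.
    obtain ⟨w, hw⟩ := exists_rescaled_limit_eq hlam cp0 cp1 cq0 hk hlim
      (w₀ := w₀) (by rwa [hhw₀]) (x := fun l : ℕ => x (-l)) (fun l => by
        rw [hx.2.1 _ (by omega)]
        congr 1
        push_cast
        ring) hx.2.2
    obtain ⟨N, hN⟩ :=
      exists_omegaSet_criticalDisk_eq hlam cp0 cp1 cq0 hx₀ hk hν hν3 hh hx hw
    exact ⟨w / lam ^ N, x₀, _, Real.rpow_pos_of_pos hμ0 _, hN N le_rfl⟩
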